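/- **Setting.** Let $G=(V,E)$ be a finite simple graph and $n\ge 2$ a known upper bound on $|V|$; let $0<\beta<1$ with $1/\beta$ an integer. *Local-Broadcast.* A call to Local-Broadcast on $G$ is given by disjoint vertex sets $\mathcal S$ (senders) and $\mathcal R$ (receivers), where each $u\in\mathcal S$ holds a message $m_u$. An implementation with failure probability $f$ returns to each $v\in\mathcal R$ either nothing or one of the messages $m_u$ with $u\in N(v)\cap\mathcal S$, and for every $v\in\mathcal R$ with $N(v)\cap\mathcal S\ne\emptyset$ it returns such a message with probability at least $1-f$. Different calls use independent randomness. The vertices in $\mathcal S\cup\mathcal R$ participate in the call. *Cluster graph.* Every $v\in V$ independently draws $\delta_v\sim\mathrm{Exponential}(\beta)$ (mean $1/\beta$) and $v$ joins the cluster $\mathsf{Cl}(v)$ centred at a $u$ that minimizes $\mathsf{dist}_G(v,u)-\delta_u$. The vertices of $G^*=\mathsf{cluster}(G,\beta)$ are the clusters; two distinct clusters are adjacent iff an edge of $G$ joins them. Each cluster $C$ moreover has a shared random set $S_C\subseteq\{1,\dots,\ell\}$, drawn by its centre independently of everything else, that contains each index independently with probability $1/c$. Every vertex knows the identifier of its cluster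 $C$, the set $S_C$, and its layer, i.e. its distance to the centre of $C$. *Simulation.* In a call to Local-Broadcast on $G^*$ each cluster is a sender, a receiver, or neither; the members of a cluster know which, and the message $m_C$ of a sender cluster $C$ is known to its centre. The call is simulated by the following calls to Local-Broadcast on $G$, in which every message is one of the messages $m_C$ together with one cluster identifier. 1. Down-cast in the sender clusters: $D$ stages of $\ell$ steps. In step $j$ of stage $i$, among the members of sender clusters $C$ with $j\in S_C$, those in layer $i-1$ that hold a message send it and those in layer $i$ listen. Messages with the identifier of another cluster are ignored. 2. One Local-Broadcast, in which the members of sender clusters that hold a message send it and the members of receiver clusters listen. 3. Up-cast in the receiver clusters: like the Down-cast, with stages $i=D,\dots,1$, senders in layer $i$ and listeners in layer $i-1$. What the centre of a receiver cluster then holds, if anything, is what that cluster receives. **Lemma.** For every integer $b\ge 0$ there is a constant $K$ such that for all $n$ and $\beta$ as above there are integers $c\ge1$ and $\ell, D\ge 0$, depending only on $b$, $n$, $\beta$, with the following properties. * The simulation consists of at most $K\,\dfrac{\log^3 n}{\beta\log(1/\beta)}$ calls to Local-Broadcast on $G$. * For every graph $G$ with at most $n$ vertices, with probability at least $1-n^{-b}$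 over the clustering and the shared sets $S_C$, both of the following hold for every $f$ and every implementation of Local-Broadcast on $G$ with failure probability $f$: the simulation is an implementation of Local-Broadcast on $G^*$ with failure probability $3nf$; and in the simulation of any call on $G^*$, each vertex of $G$ participates in at most $K\log n$ of the calls to Local-Broadcast on $G$. -/

import Mathlib

open MeasureTheory ProbabilityTheory
open scoped ENNReal

universe u v w

/-! ### Local-Broadcast -/

/-- What a vertex does in one call to Local-Broadcast: stay out of the call, take part as a sender
holding a message, or take part as a receiver.  An assignment `a : V → LBAction M` thus is a pair of
disjoint sets (the senders `𝒮`, the receivers `ℛ`) with a message for every sender. -/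
inductive LBAction (M : Type*) where
  | idle : LBAction M
  | send (m : M) : LBAction M
  | listen : LBAction M

/-- `LB` is an implementation of Local-Broadcast on the graph `G` with failure probability `f`;
`LB a` is the joint law of what the vertices receive (`none`: nothing).
* A vertex receives only if it listens, and only messages held by a sender among its neighbours.
* A receiver with at least one neighbouring sender receives the message of at least one
  neighbouring sender with probability at least `1 - f`. -/
structure IsLocalBroadcast {V M : Type*} (G : SimpleGraph V)
    (LB : (V → LBAction M) → PMF (V → Option M)) (f : ℝ≥0∞) : Prop where
  sound : ∀ (a : V → LBAction M), ∀ o ∈ (LB a).support, ∀ (v : V) (m : M), o v = some m →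
    a v = LBAction.listen ∧ ∃ u, G.Adj v u ∧ a u = LBAction.send m
  complete : ∀ (a : V → LBAction M) (v : V), a v = LBAction.listen →
    (∃ u m, G.Adj v u ∧ a u = LBAction.send m) →
    1 - f ≤ (LB a).toOuterMeasure
      {o | ∃ u m, G.Adj v u ∧ a u = LBAction.send m ∧ o v = some m}

/-! ### Distributed algorithms that communicate through Local-Broadcast only -/

/-- One call to Local-Broadcast inside a distributed algorithm: every vertex chooses its action from
its own local state (of type `σ`) and afterwards updates that state with what it received. -/
structure Round (σ M : Type*) where
  act : σ → LBAction M
  upd : σ → Option M → σ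

open Classical in
/-- Execute a list of rounds on the local states `s`, each round by one call to `LB` with fresh
randomness.  The result is the joint law of the final local states and of the number of calls in
which each vertex participated (as a sender or as a receiver). -/
noncomputable def run {V σ M : Type*} (LB : (V → LBAction M) → PMF (V → Option M)) :
    List (Round σ M) → (V → σ) → PMF ((V → σ) × (V → ℕ))
  | [], s => PMF.pure (s, fun _ => 0)
  | r :: rs, s =>
      (LB fun v => r.act (s v)).bind fun o =>
        (run LB rs fun v => r.upd (s v) (o v)).map fun p =>
          (p.1, fun v => p.2 v + if r.act (s v) = LBAction.idle then 0 else 1)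

/-! ### The cluster graph -/

/-- `cl` sends every vertex `v` to the centre of its cluster, a vertex `u` that minimizes
`dist(v, u) - δ u` (vertices in other components of `G` are at infinite distance). -/
structure IsClustering {V : Type*} (G : SimpleGraph V) (δ : V → ℝ) (cl : V → V) : Prop where
  reachable : ∀ v, G.Reachable v (cl v)
  minimal : ∀ v u, G.Reachable v u →
    (G.dist v (cl v) : ℝ) - δ (cl v) ≤ (G.dist v u : ℝ) - δ u

/-- The cluster graph.  A cluster `{v | cl v = C}` is named by its centre `C`; two distinct clusters
are adjacent iff some edge of `G` joins them. -/
def clusterGraph {V : Type*} (G : SimpleGraph V) (cl : V → V) :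
    SimpleGraph (Set.range cl) where
  Adj C C' := C ≠ C' ∧ ∃ u v, G.Adj u v ∧ cl u = C ∧ cl v = C'
  symm := ⟨fun _ _ h => ⟨h.1.symm, by
    obtain ⟨-, u, v, huv, hu, hv⟩ := h
    exact ⟨v, u, huv.symm, hv, hu⟩⟩⟩
  loopless := ⟨fun _ h => h.1 rfl⟩

/-- A coin with success probability `p`. -/
noncomputable def coin (p : ℝ) : Measure Bool :=
  ENNReal.ofReal p • Measure.dirac true + ENNReal.ofReal (1 - p) • Measure.dirac false

/-- The randomness of the clustering: independently, every vertex `v` draws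
`δ v ~ Exponential(β)` (mean `1/β`) and a random subset of the `ℓ` indices, given by its indicator
function, that contains each index independently with probability `1/c`. -/
noncomputable def clusterMeasure (V : Type*) [Fintype V] (β : ℝ) (c ℓ : ℕ) :
    Measure ((V → ℝ) × (V → Fin ℓ → Bool)) :=
  (Measure.pi fun _ : V => expMeasure β).prod
    (Measure.pi fun _ : V => Measure.pi fun _ : Fin ℓ => coin (1 / c))

/-! ### The simulation -/

/-- The role of a cluster in a call to Local-Broadcast on the cluster graph. -/
inductive Role where
  | sender | receiver | bystander

def LBAction.role {M : Type*} : LBAction M → Role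
  | .idle => .bystander
  | .send _ => .sender
  | .listen => .receiver

def LBAction.message {M : Type*} : LBAction M → Option M
  | .send m => some m
  | _ => none

/-- The local state of a vertex: the role, the identifier and the shared index set of its cluster,
its own layer in the cluster, and the message that it currently holds, if any. -/
structure VertexState (M I : Type*) (ℓ : ℕ) where
  role : Role
  clusterId : I
  layer : ℕ
  idx : Fin ℓ → Bool
  held : Option M

section
variable (M I : Type*) (ℓ : ℕ)

open Classical in
/-- One step of a cast: in the clusters with role `ρ` whose index set contains `j`, the vertices of
layer `src` that hold a message send it, together with the identifier of their cluster, and the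
vertices of layer `dst` listen; a message with the identifier of another cluster is ignored. -/
noncomputable def castRound (ρ : Role) (src dst : ℕ) (j : Fin ℓ) :
    Round (VertexState M I ℓ) (M × I) where
  act s :=
    if s.role = ρ ∧ s.idx j = true then
      if s.layer = src then
        match s.held with
        | some m => .send (m, s.clusterId)
        | none => .idle
      else if s.layer = dst then .listen
      else .idle
    else .idle
  upd s o :=
    match o with
    | some (m, i) => if i = s.clusterId then { s with held := some m } else s
    | none => s

/-- Down-cast in the sender clusters: `D` stages of `ℓ` steps, from layer `i` to layer `i + 1` for
`i = 0, …, D - 1`. -/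
noncomputable def downCast (D : ℕ) : List (Round (VertexState M I ℓ) (M × I)) :=
  (List.range D).flatMap fun i =>
    (List.finRange ℓ).map fun j => castRound M I ℓ Role.sender i (i + 1) j

/-- Up-cast in the receiver clusters: `D` stages of `ℓ` steps, from layer `i + 1` to layer `i` for
`i = D - 1, …, 0`. -/
noncomputable def upCast (D : ℕ) : List (Round (VertexState M I ℓ) (M × I)) :=
  (List.range D).reverse.flatMap fun i =>
    (List.finRange ℓ).map fun j => castRound M I ℓ Role.receiver (i + 1) i j

/-- One call in which the members of sender clusters send the message they hold, and the members of
receiver clusters listen. -/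
def exchangeRound : Round (VertexState M I ℓ) (M × I) where
  act s :=
    match s.role with
    | .sender =>
      match s.held with
      | some m => .send (m, s.clusterId)
      | none => .idle
    | .receiver => .listen
    | .bystander => .idle
  upd s o :=
    match o with
    | some (m, _) => { s with held := some m }
    | none => s

/-- The simulation of one call to Local-Broadcast on the cluster graph. -/
noncomputable def simulation (D : ℕ) : List (Round (VertexState M I ℓ) (M × I)) :=
  downCast M I ℓ D ++ [exchangeRound M I ℓ] ++ upCast M I ℓ D

end

open Classical in
/-- The local states before the simulation of the call `a` on the cluster graph.  Every vertex knows
the role, the identifier (that of the centre) and the index set (that drawn by the centre) of its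
cluster and its layer, the distance to the centre; only the centre of a sender cluster holds the
message of the cluster. -/
noncomputable def initialState {V M I : Type*} {ℓ : ℕ} (G : SimpleGraph V) (cl : V → V)
    (ident : V → I) (S : V → Fin ℓ → Bool) (a : Set.range cl → LBAction M) (v : V) :
    VertexState M I ℓ where
  role := (a ⟨cl v, v, rfl⟩).role
  clusterId := ident (cl v)
  layer := G.dist v (cl v)
  idx := S (cl v)
  held := if v = cl v then (a ⟨cl v, v, rfl⟩).message else none

/-- What a vertex outputs at the end: the message it holds, if its cluster is a receiver. -/
def VertexState.output {M I : Type*} {ℓ : ℕ} (s : VertexState M I ℓ) : Option M :=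
  match s.role with
  | .receiver => s.held
  | _ => none

/-- The joint law of the final local states and of the numbers of calls in which the vertices
participated, when the call `a` on the cluster graph is simulated with `LB` on `G`. -/
noncomputable def simulationRun {V M I : Type*} {ℓ : ℕ} (G : SimpleGraph V) (cl : V → V)
    (ident : V → I) (S : V → Fin ℓ → Bool) (D : ℕ)
    (LB : (V → LBAction (M × I)) → PMF (V → Option (M × I))) (a : Set.range cl → LBAction M) :
    PMF ((V → VertexState M I ℓ) × (V → ℕ)) :=
  run LB (simulation M I ℓ D) (initialState G cl ident S a)

/-- The simulated Local-Broadcast on the cluster graph: a cluster receives what its centre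
outputs. -/
noncomputable def simulatedLB {V M I : Type*} {ℓ : ℕ} (G : SimpleGraph V) (cl : V → V)
    (ident : V → I) (S : V → Fin ℓ → Bool) (D : ℕ)
    (LB : (V → LBAction (M × I)) → PMF (V → Option (M × I))) (a : Set.range cl → LBAction M) :
    PMF (Set.range cl → Option M) :=
  (simulationRun G cl ident S D LB a).map fun p C => (p.1 C).output

/-! Write `k = 1/β`, let `m` be of order `log n` and `t` of order `log n / log k`, and take `c =
2t`, `ℓ = 2cm`. The proof separates a random event about the clustering and the index sets from the
analysis of the simulation on that event. The event does not mention the implementation of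
Local-Broadcast, so it serves all of them at once.

On the event: almost surely no two shifts `δ` differ by an integer, so every vertex has a unique
best centre. A neighbour one step closer to that centre has the same best centre, so each layer of a
cluster is fed by the layer before it. Suppose that among the clusters meeting the closed
neighbourhood of a vertex, its own always has a private index. In the call with that index every
sender the vertex can hear belongs to its own cluster, so a stage of a cast passes a message along a
given parent edge with failure at most `f`. Messages are never erased, so a union bound along sender
path, crossing edge and receiver path costs at most `n + 1 + n ≤ 3n` failures
(`simulation_runFail_le`). Soundness is deterministic: the invariant `Consistent` says that every
held message is one its holder may have. A vertex acts in at most two stages of each cast, and there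
only at the indices of its cluster, which bounds its participation by `4|S_C| + 1`.

The event is likely: the centres near a vertex `v` are within `2` of the maximum of `δ u -
dist(v,u)`. By memorylessness, more than `t` vertices are that close with probability at most `n
q^t`, where `q = 1 - exp(-2β) ≤ k^(-1/3)` (`measure_nearMax_card_gt_le`); this is the source of the
factor `1/log(1/β)`. With at most `t` competitors an index is private with probability at least
`1/(2c)`, so all `ℓ` fail with probability at most `exp(-m)`. A Chernoff bound gives `|S_C| ≤ 5m`,
and an exponential tail gives radius at most `km`.

The number of calls is `2Dℓ + 1` with `ℓ = 4tm`. Usually `D = km`; if `k ≥ n²`, rounding up `t`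
would spoil the bound, and the trivial depth `D = n` is used instead (`length_bound`). -/

/-! ### Failure probabilities of executions -/

section Run

variable {V σ M : Type*} (LB : (V → LBAction M) → PMF (V → Option M))

/-- The probability that the final local states of an execution violate `P`. -/
noncomputable def runFail (rs : List (Round σ M)) (s : V → σ) (P : (V → σ) → Prop) : ℝ≥0∞ :=
  (run LB rs s).toOuterMeasure {p | ¬ P p.1}

/-- The actions of the vertices in a round. -/
def Round.acts (r : Round σ M) (s : V → σ) (v : V) : LBAction M := r.act (s v)

/-- The local states after a round. -/
def Round.step (r : Round σ M) (s : V → σ) (o : V → Option M) (v : V) : σ := r.upd (s v) (o v)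

/-- A round preserves a property of the local states, whatever the implementation returns. -/
def Round.Preserves (r : Round σ M) (P : (V → σ) → Prop) : Prop :=
  ∀ s, P s → ∀ o ∈ (LB (r.acts s)).support, P (r.step s o)

theorem PMF.toOuterMeasure_le_one {α : Type*} (p : PMF α) (A : Set α) :
    p.toOuterMeasure A ≤ 1 := by
  rw [PMF.toOuterMeasure_apply, ← p.tsum_coe]
  exact ENNReal.tsum_le_tsum fun x => Set.indicator_le_self _ _ x

theorem PMF.toOuterMeasure_add_compl {α : Type*} (p : PMF α) (A : Set α) :
    p.toOuterMeasure A + p.toOuterMeasure Aᶜ = 1 := by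
  rw [PMF.toOuterMeasure_apply, PMF.toOuterMeasure_apply, ← ENNReal.tsum_add, ← p.tsum_coe]
  congr 1
  ext x
  by_cases h : x ∈ A <;> simp [h]

theorem PMF.toOuterMeasure_compl_le {α : Type*} (p : PMF α) {A : Set α} {f : ℝ≥0∞}
    (h : 1 - f ≤ p.toOuterMeasure A) : p.toOuterMeasure Aᶜ ≤ f := by
  have h1 := p.toOuterMeasure_add_compl A
  have hA : p.toOuterMeasure A ≠ ∞ := ((p.toOuterMeasure_le_one A).trans_lt (by simp)).ne
  have h2 : 1 ≤ p.toOuterMeasure A + f := by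
    rw [add_comm]; exact tsub_le_iff_left.mp h
  rw [← h1] at h2
  exact (ENNReal.add_le_add_iff_left hA).mp h2

theorem PMF.le_toOuterMeasure_of_compl {α : Type*} (p : PMF α) {A : Set α} {f : ℝ≥0∞}
    (h : p.toOuterMeasure Aᶜ ≤ f) : 1 - f ≤ p.toOuterMeasure A := by
  rw [tsub_le_iff_left, ← p.toOuterMeasure_add_compl A, add_comm]
  gcongr

variable {LB}

theorem runFail_nil {s : V → σ} {P : (V → σ) → Prop} (h : P s) : runFail LB [] s P = 0 := by
  simp [runFail, run, PMF.toOuterMeasure_pure_apply, h]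

theorem runFail_cons (r : Round σ M) (rs : List (Round σ M)) (s : V → σ) (P : (V → σ) → Prop) :
    runFail LB (r :: rs) s P =
      ∑' o, LB (r.acts s) o * runFail LB rs (r.step s o) P := by
  rw [runFail, run, PMF.toOuterMeasure_bind_apply]
  congr 1
  ext o
  rw [PMF.toOuterMeasure_map_apply]
  rfl

/-- Union bound: either the first list misses the intermediate goal `Q`, or the second fails from a
state satisfying `Q`. All failure estimates for the simulation are compositions of this one. -/
theorem runFail_append_le (rs₁ rs₂ : List (Round σ M)) (s : V → σ) {P Q : (V → σ) → Prop}
    {ε : ℝ≥0∞} (h : ∀ s, Q s → runFail LB rs₂ s P ≤ ε) :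
    runFail LB (rs₁ ++ rs₂) s P ≤ runFail LB rs₁ s Q + ε := by
  induction rs₁ generalizing s with
  | nil =>
    by_cases hQ : Q s
    · simpa [runFail_nil hQ] using h s hQ
    · have h1 : runFail LB [] s Q = 1 := by
        simp [runFail, run, PMF.toOuterMeasure_pure_apply, hQ]
      rw [h1]
      exact (PMF.toOuterMeasure_le_one _ _).trans le_self_add
  | cons r rs ih =>
    rw [List.cons_append, runFail_cons, runFail_cons]
    calc _ ≤ ∑' o, (LB (r.acts s) o * runFail LB rs (r.step s o) Q + LB (r.acts s) o * ε) := by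
          refine ENNReal.tsum_le_tsum fun o => ?_
          rw [← mul_add]
          gcongr
          exact ih _
      _ = _ := by
          rw [ENNReal.tsum_add, ENNReal.tsum_mul_right, PMF.tsum_coe, one_mul]

theorem runFail_eq_zero_of_preserves {rs : List (Round σ M)} {P : (V → σ) → Prop}
    (h : ∀ r ∈ rs, r.Preserves LB P) {s : V → σ} (hs : P s) : runFail LB rs s P = 0 := by
  induction rs generalizing s with
  | nil => exact runFail_nil hs
  | cons r rs ih =>
    rw [runFail_cons, ENNReal.tsum_eq_zero]
    intro o
    by_cases ho : o ∈ (LB (r.acts s)).support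
    · rw [ih (fun r' hr' => h r' (List.mem_cons_of_mem _ hr'))
        (h r List.mem_cons_self s hs o ho), mul_zero]
    · rw [PMF.mem_support_iff, not_not] at ho
      rw [ho, zero_mul]

theorem runFail_append_le_of_preserves_right {rs₁ rs₂ : List (Round σ M)} {s : V → σ}
    {P : (V → σ) → Prop} (h : ∀ r ∈ rs₂, r.Preserves LB P) :
    runFail LB (rs₁ ++ rs₂) s P ≤ runFail LB rs₁ s P := by
  simpa using runFail_append_le (LB := LB) rs₁ rs₂ s (P := P) (Q := P) (ε := 0)
    fun s hs => (runFail_eq_zero_of_preserves h hs).le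

theorem runFail_append_le_of_preserves_left {rs₁ rs₂ : List (Round σ M)} {s : V → σ}
    {P Q : (V → σ) → Prop} {ε : ℝ≥0∞} (h : ∀ r ∈ rs₁, r.Preserves LB Q) (hs : Q s)
    (h₂ : ∀ s, Q s → runFail LB rs₂ s P ≤ ε) :
    runFail LB (rs₁ ++ rs₂) s P ≤ ε := by
  simpa [runFail_eq_zero_of_preserves h hs] using runFail_append_le (LB := LB) rs₁ rs₂ s h₂

theorem runFail_singleton_le (r : Round σ M) (s : V → σ) (P : (V → σ) → Prop)
    {A : Set (V → Option M)} {f : ℝ≥0∞} (hA : 1 - f ≤ (LB (r.acts s)).toOuterMeasure A)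
    (h : ∀ o ∈ A, o ∈ (LB (r.acts s)).support → P (r.step s o)) :
    runFail LB [r] s P ≤ f := by
  refine le_trans ?_ (PMF.toOuterMeasure_compl_le _ hA)
  rw [runFail_cons, PMF.toOuterMeasure_apply]
  refine ENNReal.tsum_le_tsum fun o => ?_
  by_cases ho : o ∈ (LB (r.acts s)).support
  · by_cases hoA : o ∈ A
    · rw [runFail_nil (h o hoA ho), mul_zero]
      exact zero_le
    · rw [Set.indicator_of_mem (by simpa using hoA)]
      exact mul_le_of_le_one_right' (PMF.toOuterMeasure_le_one _ _)
  · rw [PMF.mem_support_iff, not_not] at ho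
    rw [ho, zero_mul]
    exact zero_le

theorem forall_mem_support_run_of_preserves {rs : List (Round σ M)} {P : (V → σ) → Prop}
    (h : ∀ r ∈ rs, r.Preserves LB P) {s : V → σ} (hs : P s) :
    ∀ p ∈ (run LB rs s).support, P p.1 := by
  have h0 := runFail_eq_zero_of_preserves h hs
  rw [runFail, PMF.toOuterMeasure_apply_eq_zero_iff] at h0
  intro p hp
  by_contra hP
  exact Set.disjoint_left.mp h0 hp hP

/-- If every round preserves `P`, and `P` implies that `v` participates in a round `r` only if
`1 ≤ cost r`, then `v` participates in at most `∑ cost r` rounds. -/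
theorem participation_le {rs : List (Round σ M)} {P : (V → σ) → Prop} {v : V}
    (cost : Round σ M → ℕ) (h : ∀ r ∈ rs, r.Preserves LB P)
    (hc : ∀ r ∈ rs, ∀ s, P s → r.act (s v) ≠ LBAction.idle → 1 ≤ cost r)
    {s : V → σ} (hs : P s) :
    ∀ p ∈ (run LB rs s).support, p.2 v ≤ (rs.map cost).sum := by
  induction rs generalizing s with
  | nil =>
    intro p hp
    rw [run, PMF.mem_support_pure_iff] at hp
    simp [hp]
  | cons r rs ih =>
    intro p hp
    rw [run, PMF.mem_support_bind_iff] at hp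
    obtain ⟨o, ho, hp⟩ := hp
    rw [PMF.mem_support_map_iff] at hp
    obtain ⟨q, hq, rfl⟩ := hp
    have h1 := ih (fun r' hr' => h r' (List.mem_cons_of_mem _ hr'))
      (fun r' hr' => hc r' (List.mem_cons_of_mem _ hr'))
      (h r List.mem_cons_self s hs o ho) q hq
    have h2 := hc r List.mem_cons_self s hs
    simp only [List.map_cons, List.sum_cons]
    split_ifs with hi
    · lia
    · have := h2 hi
      lia

end Run

/-! ### The simulation on a good clustering -/

section Simulation

variable {V M I : Type*} {ℓ : ℕ}

theorem LBAction.role_eq_sender {x : LBAction M} : x.role = Role.sender ↔ ∃ m, x = .send m := by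
  cases x <;> simp [LBAction.role]

theorem LBAction.role_eq_receiver {x : LBAction M} : x.role = Role.receiver ↔ x = .listen := by
  cases x <;> simp [LBAction.role]

/-- The properties of the clustering and of the shared index sets on which the correctness of the
simulation relies. -/
structure GoodClustering (G : SimpleGraph V) (cl : V → V) (S : V → Fin ℓ → Bool) : Prop where
  centre : ∀ v, cl (cl v) = cl v
  reachable : ∀ v, G.Reachable v (cl v)
  parent : ∀ v i, G.dist v (cl v) = i + 1 →
    ∃ w, G.Adj v w ∧ cl w = cl v ∧ G.dist w (cl v) = i
  index : ∀ v, ∃ j, S (cl v) j = true ∧ ∀ x, G.Adj v x → cl x ≠ cl v → S (cl x) j = false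

variable (G : SimpleGraph V) (cl : V → V) (ident : V → I) (S : V → Fin ℓ → Bool)
  (a : Set.range cl → LBAction M)

/-- The cluster of a vertex, as a vertex of the cluster graph. -/
def clusterOf (v : V) : Set.range cl := ⟨cl v, v, rfl⟩

/-- The messages that members of the cluster `C` may hold. -/
def Legit (C : Set.range cl) (m : M) : Prop :=
  a C = .send m ∨ (a C = .listen ∧ ∃ C', (clusterGraph G cl).Adj C C' ∧ a C' = .send m)

/-- The local states are those that can occur in the simulation of the call `a`. -/
structure Consistent (s : V → VertexState M I ℓ) : Prop where
  role : ∀ v, (s v).role = (a (clusterOf cl v)).role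
  clusterId : ∀ v, (s v).clusterId = ident (cl v)
  layer : ∀ v, (s v).layer = G.dist v (cl v)
  idx : ∀ v, (s v).idx = S (cl v)
  held : ∀ v m, (s v).held = some m → Legit G cl a (clusterOf cl v) m

theorem consistent_initialState :
    Consistent G cl ident S a (initialState G cl ident S a) where
  role _ := rfl
  clusterId _ := rfl
  layer _ := rfl
  idx _ := rfl
  held v m h := by
    left
    simp only [initialState] at h
    split_ifs at h
    change (a (clusterOf cl v)).message = some m at h
    generalize a (clusterOf cl v) = z at h ⊢
    cases z <;> simp_all [LBAction.message]

/-- The states are consistent and `v` holds a message. -/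
def Holds (v : V) (s : V → VertexState M I ℓ) : Prop :=
  Consistent G cl ident S a s ∧ (s v).held.isSome

variable {G cl ident S a} {LB : (V → LBAction (M × I)) → PMF (V → Option (M × I))} {f : ℝ≥0∞}

/-! ### Single rounds and the invariants they preserve. -/

theorem castRound_act_eq_send {ρ : Role} {src dst : ℕ} {j : Fin ℓ} {s : VertexState M I ℓ}
    {p : M × I} :
    (castRound M I ℓ ρ src dst j).act s = .send p ↔
      s.role = ρ ∧ s.idx j = true ∧ s.layer = src ∧ s.held = some p.1 ∧ s.clusterId = p.2 := by
  obtain ⟨m, i⟩ := p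
  rcases s with ⟨r, id, la, ix, h⟩
  cases h <;> simp only [castRound] <;> split_ifs <;> simp_all

theorem castRound_act_eq_listen {ρ : Role} {src dst : ℕ} {j : Fin ℓ} {s : VertexState M I ℓ}
    (h : src ≠ dst) (hr : s.role = ρ) (hj : s.idx j = true) (hl : s.layer = dst) :
    (castRound M I ℓ ρ src dst j).act s = .listen := by
  simp [castRound, hr, hj, hl, h.symm]

theorem castRound_act_ne_idle {ρ : Role} {src dst : ℕ} {j : Fin ℓ} {s : VertexState M I ℓ}
    (h : (castRound M I ℓ ρ src dst j).act s ≠ .idle) :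
    s.idx j = true ∧ (s.layer = src ∨ s.layer = dst) := by
  simp only [castRound] at h
  split_ifs at h <;> simp_all

theorem castRound_upd (ρ : Role) (src dst : ℕ) (j : Fin ℓ) (s : VertexState M I ℓ)
    (o : Option (M × I)) :
    (castRound M I ℓ ρ src dst j).upd s o = s ∨
      ∃ m, o = some (m, s.clusterId) ∧
        (castRound M I ℓ ρ src dst j).upd s o = { s with held := some m } := by
  rcases o with _ | ⟨m, i⟩
  · exact Or.inl rfl
  · by_cases h : i = s.clusterId
    · right; exact ⟨m, by simp [h], by simp [castRound, h]⟩
    · left; simp [castRound, h]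

theorem exchangeRound_act_eq_send {s : VertexState M I ℓ} {p : M × I} :
    (exchangeRound M I ℓ).act s = .send p ↔
      s.role = .sender ∧ s.held = some p.1 ∧ s.clusterId = p.2 := by
  obtain ⟨m, i⟩ := p
  rcases s with ⟨r, id, la, ix, h⟩
  cases r <;> cases h <;> simp [exchangeRound]

theorem exchangeRound_act_eq_listen {s : VertexState M I ℓ} :
    (exchangeRound M I ℓ).act s = .listen ↔ s.role = .receiver := by
  rcases s with ⟨r, id, la, ix, h⟩
  cases r <;> cases h <;> simp [exchangeRound]

theorem exchangeRound_upd (s : VertexState M I ℓ) (o : Option (M × I)) :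
    (exchangeRound M I ℓ).upd s o = s ∨
      ∃ m i, o = some (m, i) ∧ (exchangeRound M I ℓ).upd s o = { s with held := some m } := by
  rcases o with _ | ⟨m, i⟩
  · exact Or.inl rfl
  · exact Or.inr ⟨m, i, rfl, rfl⟩

/-- A round that only changes held messages, to legitimate ones, keeps the states consistent and
never erases a message. -/
theorem Consistent.step {s : V → VertexState M I ℓ} (hs : Consistent G cl ident S a s)
    {r : Round (VertexState M I ℓ) (M × I)} {o : V → Option (M × I)}
    (h : ∀ v, r.upd (s v) (o v) = s v ∨
      ∃ m, Legit G cl a (clusterOf cl v) m ∧ r.upd (s v) (o v) = { s v with held := some m }) :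
    Consistent G cl ident S a (r.step s o) ∧
      ∀ v, (s v).held.isSome → (r.step s o v).held.isSome := by
  have key : ∀ v, r.step s o v = s v ∨
      ∃ m, Legit G cl a (clusterOf cl v) m ∧ r.step s o v = { s v with held := some m } := h
  refine ⟨⟨fun v => ?_, fun v => ?_, fun v => ?_, fun v => ?_, fun v m hm => ?_⟩, fun v hv => ?_⟩
  all_goals rcases key v with e | ⟨m', hm', e⟩ <;> try rw [e]
  · exact hs.role v
  · exact hs.role v
  · exact hs.clusterId v
  · exact hs.clusterId v
  · exact hs.layer v
  · exact hs.layer v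
  · exact hs.idx v
  · exact hs.idx v
  · exact hs.held v m (e ▸ hm)
  · rw [e] at hm
    simp only [Option.some.injEq] at hm
    exact hm ▸ hm'
  · exact hv
  · rfl

theorem castRound_step (hLB : IsLocalBroadcast G LB f) (hid : Function.Injective ident)
    (ρ : Role) (src dst : ℕ) (j : Fin ℓ) {s : V → VertexState M I ℓ}
    (hs : Consistent G cl ident S a s) {o : V → Option (M × I)}
    (ho : o ∈ (LB ((castRound M I ℓ ρ src dst j).acts s)).support) :
    Consistent G cl ident S a ((castRound M I ℓ ρ src dst j).step s o) ∧
      ∀ v, (s v).held.isSome → ((castRound M I ℓ ρ src dst j).step s o v).held.isSome := by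
  refine hs.step fun v => ?_
  rcases castRound_upd ρ src dst j (s v) (o v) with h | ⟨m, hm, h⟩
  · exact Or.inl h
  · refine Or.inr ⟨m, ?_, h⟩
    obtain ⟨-, x, -, hx⟩ := hLB.sound _ o ho v _ hm
    obtain ⟨-, -, -, hx, hxid⟩ := castRound_act_eq_send.mp hx
    -- An accepted message carries the listener's own cluster identifier, and identifiers are
    -- injective, so legitimacy at the sender is legitimacy at the listener.
    have hcl : clusterOf cl x = clusterOf cl v := by
      rw [hs.clusterId, hs.clusterId] at hxid
      exact Subtype.ext (hid hxid)
    exact hcl ▸ hs.held x m hx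

theorem exchangeRound_step (hLB : IsLocalBroadcast G LB f) {s : V → VertexState M I ℓ}
    (hs : Consistent G cl ident S a s) {o : V → Option (M × I)}
    (ho : o ∈ (LB ((exchangeRound M I ℓ).acts s)).support) :
    Consistent G cl ident S a ((exchangeRound M I ℓ).step s o) ∧
      ∀ v, (s v).held.isSome → ((exchangeRound M I ℓ).step s o v).held.isSome := by
  refine hs.step fun v => ?_
  rcases exchangeRound_upd (s v) (o v) with h | ⟨m, i, hm, h⟩
  · exact Or.inl h
  · refine Or.inr ⟨m, ?_, h⟩
    obtain ⟨hv, x, hvx, hx⟩ := hLB.sound _ o ho v _ hm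
    obtain ⟨hxr, hx, -⟩ := exchangeRound_act_eq_send.mp hx
    replace hv := exchangeRound_act_eq_listen.mp hv
    rw [hs.role, LBAction.role_eq_receiver] at hv
    rw [hs.role, LBAction.role_eq_sender] at hxr
    obtain ⟨m', hxr⟩ := hxr
    -- The exchange does not check identifiers. The two clusters differ nevertheless, because one is
    -- a sender and the other a receiver.
    rcases hs.held x m hx with h' | ⟨h', -⟩
    · refine Or.inr ⟨hv, clusterOf cl x, ⟨fun e => ?_, v, x, hvx, rfl, rfl⟩, h'⟩
      rw [← e, hv] at h'
      cases h'
    · rw [hxr] at h'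
      cases h'

theorem Round.Preserves.of_step {r : Round (VertexState M I ℓ) (M × I)}
    (h : ∀ s, Consistent G cl ident S a s → ∀ o ∈ (LB (r.acts s)).support,
      Consistent G cl ident S a (r.step s o) ∧
        ∀ v, (s v).held.isSome → (r.step s o v).held.isSome) :
    r.Preserves LB (Consistent G cl ident S a) ∧
      ∀ v, r.Preserves LB (Holds G cl ident S a v) :=
  ⟨fun s hs o ho => (h s hs o ho).1,
    fun v s hs o ho => ⟨(h s hs.1 o ho).1, (h s hs.1 o ho).2 v hs.2⟩⟩

/-- One stage of a cast. -/
noncomputable def castStage (M I : Type*) (ℓ : ℕ) (ρ : Role) (src dst : ℕ) :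
    List (Round (VertexState M I ℓ) (M × I)) :=
  (List.finRange ℓ).map fun j => castRound M I ℓ ρ src dst j

theorem castStage_preserves (hLB : IsLocalBroadcast G LB f) (hid : Function.Injective ident)
    (ρ : Role) (src dst : ℕ) : ∀ r ∈ castStage M I ℓ ρ src dst,
      r.Preserves LB (Consistent G cl ident S a) ∧
        ∀ v, r.Preserves LB (Holds G cl ident S a v) := by
  intro r hr
  obtain ⟨j, -, rfl⟩ := List.mem_map.mp hr
  exact Round.Preserves.of_step fun s hs o ho => castRound_step hLB hid ρ src dst j hs ho

theorem simulation_preserves (hLB : IsLocalBroadcast G LB f) (hid : Function.Injective ident)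
    (D : ℕ) : ∀ r ∈ simulation M I ℓ D,
      r.Preserves LB (Consistent G cl ident S a) ∧
        ∀ v, r.Preserves LB (Holds G cl ident S a v) := by
  intro r hr
  simp only [simulation, downCast, upCast, List.mem_append, List.mem_flatMap, List.mem_singleton]
    at hr
  rcases hr with (⟨i, -, hr⟩ | rfl) | ⟨i, -, hr⟩
  · exact castStage_preserves hLB hid _ _ _ r hr
  · exact Round.Preserves.of_step fun s hs o ho => exchangeRound_step hLB hs ho
  · exact castStage_preserves hLB hid _ _ _ r hr

/-! ### Failure probability of the casts and of the whole simulation. -/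

theorem castRound_runFail_le (hLB : IsLocalBroadcast G LB f) (hid : Function.Injective ident)
    {ρ : Role} {src dst : ℕ} (hne : src ≠ dst) {x y : V} (hxy : G.Adj y x) (hcl : cl x = cl y)
    (hx : G.dist x (cl x) = src) (hy : G.dist y (cl y) = dst)
    (hρ : (a (clusterOf cl y)).role = ρ) {j : Fin ℓ} (hj : S (cl y) j = true)
    (hj' : ∀ z, G.Adj y z → cl z ≠ cl y → S (cl z) j = false)
    {s : V → VertexState M I ℓ} (hs : Holds G cl ident S a x s) :
    runFail LB [castRound M I ℓ ρ src dst j] s (Holds G cl ident S a y) ≤ f := by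
  have hlisten : (castRound M I ℓ ρ src dst j).acts s y = .listen :=
    castRound_act_eq_listen hne (by rw [hs.1.role, hρ]) (by rw [hs.1.idx, hj])
      (by rw [hs.1.layer, hy])
  obtain ⟨m, hm⟩ := Option.isSome_iff_exists.mp hs.2
  have hsend : (castRound M I ℓ ρ src dst j).acts s x = .send (m, ident (cl x)) := by
    refine castRound_act_eq_send.mpr ⟨?_, ?_, ?_, hm, hs.1.clusterId x⟩
    · rw [hs.1.role, ← hρ]
      congr 2
      exact Subtype.ext hcl
    · rw [hs.1.idx, hcl, hj]
    · rw [hs.1.layer, hx]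
  refine runFail_singleton_le _ _ _
    (hLB.complete _ y hlisten ⟨x, _, hxy, hsend⟩) ?_
  rintro o ⟨z, ⟨m', i⟩, hyz, hz, hoy⟩ ho
  refine ⟨(castRound_step hLB hid ρ src dst j hs.1 ho).1, ?_⟩
  obtain ⟨-, hzj, -, -, hzi⟩ := castRound_act_eq_send.mp hz
  -- Privacy of `j`: the heard sender `z` need not be the parent `x`, but it is in the cluster of
  -- `y`, so its message is not ignored.
  have hclz : cl z = cl y := by
    by_contra hc
    rw [hs.1.idx, hj' z hyz hc] at hzj
    cases hzj
  have hi : i = (s y).clusterId := by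
    rw [hs.1.clusterId, ← hclz, ← hs.1.clusterId]
    exact hzi.symm
  simp [Round.step, castRound, hoy, hi]

theorem castStage_runFail_le (hLB : IsLocalBroadcast G LB f) (hid : Function.Injective ident)
    (hG : GoodClustering G cl S)
    {ρ : Role} {src dst : ℕ} (hne : src ≠ dst) {x y : V} (hxy : G.Adj y x) (hcl : cl x = cl y)
    (hx : G.dist x (cl x) = src) (hy : G.dist y (cl y) = dst)
    (hρ : (a (clusterOf cl y)).role = ρ)
    {s : V → VertexState M I ℓ} (hs : Holds G cl ident S a x s) :
    runFail LB (castStage M I ℓ ρ src dst) s (Holds G cl ident S a y) ≤ f := by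
  obtain ⟨j, hj, hj'⟩ := hG.index y
  have hpres := castStage_preserves (M := M) (S := S) (a := a) hLB hid ρ src dst
  obtain ⟨l₁, l₂, hl⟩ := List.append_of_mem (List.mem_finRange j)
  -- Only the call at the private index has to succeed. The calls before it leave `x` holding a
  -- message, and those after it leave `y` holding one.
  have hsplit : castStage M I ℓ ρ src dst =
      l₁.map (fun j => castRound M I ℓ ρ src dst j) ++ ([castRound M I ℓ ρ src dst j] ++
        l₂.map (fun j => castRound M I ℓ ρ src dst j)) := by
    rw [castStage, hl]; simp
  rw [hsplit] at hpres ⊢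
  refine runFail_append_le_of_preserves_left (Q := Holds G cl ident S a x)
    (fun r hr => (hpres r (by simp only [List.mem_append]; tauto)).2 x) hs fun s hs => ?_
  exact (runFail_append_le_of_preserves_right
    fun r hr => (hpres r (by simp only [List.mem_append]; tauto)).2 y).trans
    (castRound_runFail_le hLB hid hne hxy hcl hx hy hρ hj hj' hs)

theorem downCast_eq (D : ℕ) : downCast M I ℓ D =
    (List.range D).flatMap fun i => castStage M I ℓ .sender i (i + 1) := rfl

theorem upCast_eq (D : ℕ) : upCast M I ℓ D =
    (List.range D).reverse.flatMap fun i => castStage M I ℓ .receiver (i + 1) i := rfl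

theorem downCast_succ (D : ℕ) :
    downCast M I ℓ (D + 1) = downCast M I ℓ D ++ castStage M I ℓ .sender D (D + 1) := by
  simp [downCast_eq, List.range_succ]

theorem upCast_succ (D : ℕ) :
    upCast M I ℓ (D + 1) = castStage M I ℓ .receiver (D + 1) D ++ upCast M I ℓ D := by
  simp [upCast_eq, List.range_succ]

theorem downCast_runFail_le (hLB : IsLocalBroadcast G LB f) (hid : Function.Injective ident)
    (hG : GoodClustering G cl S) {y : V} (hρ : (a (clusterOf cl y)).role = .sender) {d : ℕ}
    (hy : G.dist y (cl y) = d) :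
    runFail LB (downCast M I ℓ d) (initialState G cl ident S a) (Holds G cl ident S a y) ≤
      d * f := by
  induction d generalizing y with
  | zero =>
    have hyc : y = cl y := (hG.reachable y).dist_eq_zero_iff.mp hy
    obtain ⟨m, hm⟩ := LBAction.role_eq_sender.mp hρ
    have : runFail LB [] (initialState G cl ident S a) (Holds G cl ident S a y) = 0 := by
      refine runFail_nil ⟨consistent_initialState G cl ident S a, ?_⟩
      simp only [initialState, if_pos hyc]
      change (a (clusterOf cl y)).message.isSome
      simp [hm, LBAction.message]
    simpa [downCast] using this
  | succ d ih =>
    obtain ⟨x, hxy, hcl, hx⟩ := hG.parent y d hy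
    rw [downCast_succ, Nat.cast_succ, add_mul, one_mul]
    rw [← hcl] at hx
    have hρx : (a (clusterOf cl x)).role = .sender := by
      rw [← hρ]; congr 2; exact Subtype.ext hcl
    refine (runFail_append_le _ _ _ (Q := Holds G cl ident S a x) fun s hs => ?_).trans
      (add_le_add_left (ih hρx hx) f)
    exact castStage_runFail_le hLB hid hG (by simp) hxy hcl hx hy hρ hs

theorem upCast_runFail_le (hLB : IsLocalBroadcast G LB f) (hid : Function.Injective ident)
    (hG : GoodClustering G cl S) {x : V} (hρ : (a (clusterOf cl x)).role = .receiver) {d : ℕ}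
    (hx : G.dist x (cl x) = d) {s : V → VertexState M I ℓ} (hs : Holds G cl ident S a x s) :
    runFail LB (upCast M I ℓ d) s (Holds G cl ident S a (cl x)) ≤ d * f := by
  induction d generalizing x s with
  | zero =>
    have hxc : x = cl x := (hG.reachable x).dist_eq_zero_iff.mp hx
    rw [← hxc]
    have := runFail_nil (LB := LB) hs
    simpa [upCast] using this
  | succ d ih =>
    obtain ⟨y, hxy, hcl, hy⟩ := hG.parent x d hx
    rw [upCast_succ, Nat.cast_succ, add_mul, one_mul, add_comm (d * f)]
    rw [← hcl] at hy
    have hρy : (a (clusterOf cl y)).role = .receiver := by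
      rw [← hρ]; congr 2; exact Subtype.ext hcl
    refine (runFail_append_le _ _ _ (Q := Holds G cl ident S a y) fun s hs => ?_).trans
      (add_le_add_left (castStage_runFail_le hLB hid hG (by simp) hxy.symm hcl.symm hx hy hρy hs) _)
    rw [← hcl]
    exact ih hρy hy hs

/-- Stages beyond the layer of `y` cannot take its message away. The bound therefore involves the
distance to the centre, which is at most `n`, and not `D`, which may be much larger. -/
theorem downCast_runFail_le_of_le (hLB : IsLocalBroadcast G LB f)
    (hid : Function.Injective ident)
    (hG : GoodClustering G cl S) {y : V} (hρ : (a (clusterOf cl y)).role = .sender) {D : ℕ}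
    (hD : G.dist y (cl y) ≤ D) :
    runFail LB (downCast M I ℓ D) (initialState G cl ident S a) (Holds G cl ident S a y) ≤
      G.dist y (cl y) * f := by
  induction D, hD using Nat.le_induction with
  | base => exact downCast_runFail_le hLB hid hG hρ rfl
  | succ D _ ih =>
    rw [downCast_succ]
    exact (runFail_append_le_of_preserves_right
      fun r hr => (castStage_preserves hLB hid _ _ _ r hr).2 y).trans ih

/-- The up-cast begins at the deepest layer, so here the superfluous stages come first; they only
have to leave `x` holding a message. -/
theorem upCast_runFail_le_of_le (hLB : IsLocalBroadcast G LB f) (hid : Function.Injective ident)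
    (hG : GoodClustering G cl S) {x : V} (hρ : (a (clusterOf cl x)).role = .receiver) {D : ℕ}
    (hD : G.dist x (cl x) ≤ D) {s : V → VertexState M I ℓ} (hs : Holds G cl ident S a x s) :
    runFail LB (upCast M I ℓ D) s (Holds G cl ident S a (cl x)) ≤ G.dist x (cl x) * f := by
  induction D, hD using Nat.le_induction generalizing s with
  | base => exact upCast_runFail_le hLB hid hG hρ rfl hs
  | succ D _ ih =>
    rw [upCast_succ]
    exact runFail_append_le_of_preserves_left (Q := Holds G cl ident S a x)
      (fun r hr => (castStage_preserves hLB hid _ _ _ r hr).2 x) hs fun s hs => ih hs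

theorem exchangeRound_runFail_le (hLB : IsLocalBroadcast G LB f)
    {x y : V} (hxy : G.Adj x y) (hx : (a (clusterOf cl x)).role = .receiver)
    (hy : (a (clusterOf cl y)).role = .sender)
    {s : V → VertexState M I ℓ} (hs : Holds G cl ident S a y s) :
    runFail LB [exchangeRound M I ℓ] s (Holds G cl ident S a x) ≤ f := by
  have hlisten : (exchangeRound M I ℓ).acts s x = .listen :=
    exchangeRound_act_eq_listen.mpr (by rw [hs.1.role, hx])
  obtain ⟨m, hm⟩ := Option.isSome_iff_exists.mp hs.2
  have hsend : (exchangeRound M I ℓ).acts s y = .send (m, ident (cl y)) :=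
    exchangeRound_act_eq_send.mpr ⟨by rw [hs.1.role, hy], hm, hs.1.clusterId y⟩
  refine runFail_singleton_le _ _ _
    (hLB.complete _ x hlisten ⟨y, _, hxy, hsend⟩) ?_
  rintro o ⟨z, ⟨m', i⟩, -, -, hox⟩ ho
  exact ⟨(exchangeRound_step hLB hs.1 ho).1, by simp [Round.step, exchangeRound, hox]⟩

theorem simulation_runFail_le (hLB : IsLocalBroadcast G LB f) (hid : Function.Injective ident)
    (hG : GoodClustering G cl S) {D : ℕ} (hD : ∀ v, G.dist v (cl v) ≤ D)
    {x y : V} (hxy : G.Adj x y) (hx : (a (clusterOf cl x)).role = .receiver)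
    (hy : (a (clusterOf cl y)).role = .sender) :
    runFail LB (simulation M I ℓ D) (initialState G cl ident S a)
      (Holds G cl ident S a (cl x)) ≤ G.dist y (cl y) * f + f + G.dist x (cl x) * f := by
  refine (runFail_append_le _ _ _ (Q := Holds G cl ident S a x)
    fun s hs => upCast_runFail_le_of_le hLB hid hG hx (hD x) hs).trans ?_
  gcongr
  refine (runFail_append_le _ _ _ (Q := Holds G cl ident S a y)
    fun s hs => exchangeRound_runFail_le hLB hxy hx hy hs).trans ?_
  gcongr
  exact downCast_runFail_le_of_le hLB hid hG hy (hD y)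

theorem Consistent.output_eq_some {s : V → VertexState M I ℓ} (hs : Consistent G cl ident S a s)
    {v : V} {m : M} (h : (s v).output = some m) :
    a (clusterOf cl v) = .listen ∧ ∃ C', (clusterGraph G cl).Adj (clusterOf cl v) C' ∧
      a C' = .send m := by
  have hr : (s v).role = .receiver ∧ (s v).held = some m := by
    rw [VertexState.output] at h
    split at h
    · exact ⟨‹_›, h⟩
    · cases h
  have hl := hr.1
  rw [hs.role, LBAction.role_eq_receiver] at hl
  rcases hs.held v m hr.2 with h' | h'
  · rw [hl] at h'; cases h'
  · exact h'

theorem isLocalBroadcast_simulatedLB (hLB : IsLocalBroadcast G LB f)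
    (hid : Function.Injective ident) (hG : GoodClustering G cl S) {D n : ℕ}
    (hD : ∀ v, G.dist v (cl v) ≤ D) (hn : ∀ v, G.dist v (cl v) ≤ n) (hn1 : 1 ≤ n) :
    IsLocalBroadcast (clusterGraph G cl) (simulatedLB (M := M) G cl ident S D LB)
      (3 * n * f) := by
  -- The output of a cluster is read off at the vertex naming it; that vertex has to be a member of
  -- the cluster.
  have hC : ∀ C : Set.range cl, clusterOf cl C = C := by
    rintro ⟨_, v, rfl⟩
    exact Subtype.ext (hG.centre v)
  have hcons (a : Set.range cl → LBAction M) : ∀ p ∈ (simulationRun G cl ident S D LB a).support,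
      Consistent G cl ident S a p.1 :=
    forall_mem_support_run_of_preserves
      (fun r hr => (simulation_preserves hLB hid D r hr).1) (consistent_initialState ..)
  constructor
  · intro a o ho C m hm
    rw [simulatedLB, PMF.mem_support_map_iff] at ho
    obtain ⟨p, hp, rfl⟩ := ho
    have := (hcons a p hp).output_eq_some hm
    rwa [hC] at this
  · rintro a C hCl ⟨C', m, ⟨hne, x, y, hxy, hx, hy⟩, hm⟩
    have hx' : clusterOf cl x = C := Subtype.ext hx
    have hy' : clusterOf cl y = C' := Subtype.ext hy
    rw [simulatedLB, PMF.toOuterMeasure_map_apply]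
    refine PMF.le_toOuterMeasure_of_compl _ ?_
    have hfail := simulation_runFail_le (M := M) (a := a) hLB hid hG hD hxy
      (by rw [hx', hCl]; rfl) (by rw [hy', hm]; rfl)
    refine le_trans (PMF.toOuterMeasure_mono _ ?_) (hfail.trans ?_)
    -- On the support the states are consistent, so any message held by a receiving centre is
    -- automatically that of a neighbouring sender cluster; failure means holding nothing.
    · rintro p ⟨hp, hps⟩ hold
      refine hp ?_
      obtain ⟨m', hm'⟩ := Option.isSome_iff_exists.mp hold.2
      have hrole : (p.1 C).role = .receiver := by
        rw [(hcons a p hps).role, hC, hCl]; rfl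
      have hout : (p.1 C).output = some m' := by
        rw [VertexState.output, hrole]
        rw [← hx]; exact hm'
      have := ((hcons a p hps).output_eq_some hout).2
      rw [hC] at this
      obtain ⟨C'', h1, h2⟩ := this
      exact ⟨C'', m', h1, h2, hout⟩
    · have h1 : (G.dist y (cl y) : ℝ≥0∞) ≤ n := by exact_mod_cast hn y
      have h2 : (G.dist x (cl x) : ℝ≥0∞) ≤ n := by exact_mod_cast hn x
      have h3 : (1 : ℝ≥0∞) ≤ n := by exact_mod_cast hn1
      calc (G.dist y (cl y) : ℝ≥0∞) * f + f + G.dist x (cl x) * f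
          = (G.dist y (cl y) + 1 + G.dist x (cl x)) * f := by ring
        _ ≤ (n + n + n) * f := by gcongr
        _ = 3 * n * f := by ring

/-! ### Participation of a single vertex. -/

open Classical in
/-- A bound for the participation of a vertex at distance `d` from its centre in a list of
stages. -/
theorem stages_participation_le (ρ : Role) {L : List ℕ} (hL : L.Nodup) (src dst : ℕ → ℕ)
    (hsrc : Function.Injective src) (hdst : Function.Injective dst)
    (T : Fin ℓ → Bool) (d : ℕ) (cost : Round (VertexState M I ℓ) (M × I) → ℕ)
    (hcost : ∀ i j, cost (castRound M I ℓ ρ (src i) (dst i) j) ≤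
      if T j = true then (if d = src i then 1 else 0) + (if d = dst i then 1 else 0) else 0) :
    ((L.flatMap fun i => castStage M I ℓ ρ (src i) (dst i)).map cost).sum ≤
      2 * (Finset.univ.filter fun j => T j = true).card := by
  -- The layer `d` is the source of at most one stage and the target of at most one.
  have hone : ∀ g : ℕ → ℕ, Function.Injective g →
      (L.map fun i => if d = g i then 1 else 0).sum ≤ 1 := by
    intro g hg
    rw [← List.sum_toFinset _ hL, ← Finset.card_filter, Finset.card_le_one]
    intro i hi i' hi'
    simp only [Finset.mem_filter] at hi hi'
    exact hg (hi.2.symm.trans hi'.2)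
  have hstage : ∀ i, ((castStage M I ℓ ρ (src i) (dst i)).map cost).sum ≤
      (Finset.univ.filter fun j => T j = true).card *
        ((if d = src i then 1 else 0) + (if d = dst i then 1 else 0)) := by
    intro i
    rw [castStage, List.map_map, ← List.ofFn_eq_map, List.sum_ofFn, Finset.card_filter,
      Finset.sum_mul]
    refine Finset.sum_le_sum fun j _ => (hcost i j).trans ?_
    split_ifs <;> simp
  rw [List.map_flatMap, List.flatMap_def, List.sum_flatten, List.map_map]
  calc _ ≤ (L.map fun i => (Finset.univ.filter fun j => T j = true).card *
        ((if d = src i then 1 else 0) + (if d = dst i then 1 else 0))).sum :=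
          List.sum_le_sum fun i _ => hstage i
    _ = (Finset.univ.filter fun j => T j = true).card *
        ((L.map fun i => if d = src i then 1 else 0).sum +
          (L.map fun i => if d = dst i then 1 else 0).sum) := by
          rw [List.sum_map_mul_left, List.sum_map_add]
    _ ≤ (Finset.univ.filter fun j => T j = true).card * (1 + 1) := by
          gcongr
          · exact hone src hsrc
          · exact hone dst hdst
    _ = _ := by ring

open Classical in
theorem simulationRun_participation_le (hLB : IsLocalBroadcast G LB f)
    (hid : Function.Injective ident) (D : ℕ) (v : V) :
    ∀ p ∈ (simulationRun G cl ident S D LB a).support,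
      p.2 v ≤ 4 * (Finset.univ.filter fun j => S (cl v) j = true).card + 1 := by
  intro p hp
  -- The cost must not depend on the random state: a round is charged as soon as some consistent
  -- state makes `v` act.
  let cost : Round (VertexState M I ℓ) (M × I) → ℕ := fun r =>
    if ∃ s, Consistent G cl ident S a s ∧ r.act (s v) ≠ LBAction.idle then 1 else 0
  have h := participation_le (v := v) cost
    (fun r hr => (simulation_preserves hLB hid D r hr).1)
    (fun r _ s hs hr => by simp only [cost]; rw [if_pos ⟨s, hs, hr⟩])
    (consistent_initialState G cl ident S a) p hp
  have hcost : ∀ ρ src dst j, cost (castRound M I ℓ ρ src dst j) ≤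
      if S (cl v) j = true then (if G.dist v (cl v) = src then 1 else 0) +
        (if G.dist v (cl v) = dst then 1 else 0) else 0 := by
    intro ρ src dst j
    simp only [cost]
    by_cases hc : ∃ s, Consistent G cl ident S a s ∧
      (castRound M I ℓ ρ src dst j).act (s v) ≠ LBAction.idle
    · rw [if_pos hc]
      obtain ⟨s, hs, hr⟩ := hc
      obtain ⟨h1, h2⟩ := castRound_act_ne_idle hr
      rw [hs.idx] at h1
      rw [hs.layer] at h2
      rw [if_pos h1]
      rcases h2 with h2 | h2 <;> simp [h2]
    · rw [if_neg hc]; exact Nat.zero_le _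
  have h1 := stages_participation_le .sender (List.nodup_range (n := D)) (fun i => i)
    (fun i => i + 1) (fun _ _ h => h) (fun _ _ h => by simpa using h) _ _ cost
    (fun i j => hcost .sender i (i + 1) j)
  have h2 := stages_participation_le .receiver (List.nodup_reverse.mpr (List.nodup_range (n := D)))
    (fun i => i + 1) (fun i => i) (fun _ _ h => by simpa using h) (fun _ _ h => h) _ _ cost
    (fun i j => hcost .receiver (i + 1) i j)
  have h3 : cost (exchangeRound M I ℓ) ≤ 1 := by
    simp only [cost]; split_ifs <;> simp
  rw [simulation, List.map_append, List.map_append, List.sum_append, List.sum_append,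
    downCast_eq, upCast_eq, List.map_singleton, List.sum_singleton] at h
  lia

theorem simulation_length (D : ℕ) : (simulation M I ℓ D).length = 2 * (D * ℓ) + 1 := by
  simp [simulation, downCast, upCast, List.length_flatMap]
  ring

end Simulation

/-! ### Clusterings without ties -/

section Clustering

variable {V : Type*} {G : SimpleGraph V} {δ : V → ℝ} {cl : V → V}

theorem SimpleGraph.Adj.dist_le_dist_add_one {v w u : V} (h : G.Adj v w) (hu : G.Reachable w u) :
    G.dist v u ≤ G.dist w u + 1 := by
  obtain ⟨p, hp⟩ := hu.exists_walk_length_eq_dist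
  rw [← hp]
  exact SimpleGraph.dist_le (SimpleGraph.Walk.cons h p)

theorem SimpleGraph.Reachable.exists_adj_dist_eq {v u : V} {i : ℕ} (hr : G.Reachable v u)
    (h : G.dist v u = i + 1) : ∃ w, G.Adj v w ∧ G.Reachable w u ∧ G.dist w u = i := by
  obtain ⟨p, hp⟩ := hr.exists_walk_length_eq_dist
  cases p with
  | nil => simp at h
  | cons hvw q =>
    rename_i w
    refine ⟨w, hvw, q.reachable, ?_⟩
    have h1 := hvw.dist_le_dist_add_one q.reachable
    have h2 := SimpleGraph.dist_le q
    rw [SimpleGraph.Walk.length_cons] at hp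
    lia

/-- No vertex can be indifferent between two centres. -/
def NoTies (δ : V → ℝ) : Prop := ∀ u u', u ≠ u' → ∀ z : ℤ, δ u - δ u' ≠ z

/-- Two different minimizers would make `δ (cl v) - δ u` a difference of graph distances, hence an
integer. -/
theorem IsClustering.eq_of_minimal (h : IsClustering G δ cl) (hδ : NoTies δ) {v u : V}
    (hr : G.Reachable v u)
    (hu : ∀ u', G.Reachable v u' → (G.dist v u : ℝ) - δ u ≤ (G.dist v u' : ℝ) - δ u') :
    cl v = u := by
  by_contra hne
  refine hδ _ _ hne ((G.dist v (cl v) : ℤ) - G.dist v u) ?_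
  push_cast
  linarith [h.minimal v u hr, hu _ (h.reachable v)]

/-- Moving from `v` to `w` gains a full unit for the centre of `v` and at most a unit for any other
candidate, so that centre stays optimal. -/
theorem IsClustering.cl_eq_of_adj (h : IsClustering G δ cl) (hδ : NoTies δ) {v w : V}
    (hvw : G.Adj v w) (hd : G.dist v (cl v) = G.dist w (cl v) + 1) : cl w = cl v := by
  refine h.eq_of_minimal hδ (hvw.reachable.symm.trans (h.reachable v)) fun u hu => ?_
  have h1 := h.minimal v u (hvw.reachable.trans hu)
  have h2 : (G.dist v u : ℝ) ≤ G.dist w u + 1 := by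
    exact_mod_cast hvw.dist_le_dist_add_one hu
  rw [hd] at h1
  push_cast at h1
  linarith

theorem IsClustering.exists_parent (h : IsClustering G δ cl) (hδ : NoTies δ) {v : V} {i : ℕ}
    (hi : G.dist v (cl v) = i + 1) :
    ∃ w, G.Adj v w ∧ cl w = cl v ∧ G.dist w (cl v) = i := by
  obtain ⟨w, hvw, -, hw⟩ := (h.reachable v).exists_adj_dist_eq hi
  exact ⟨w, hvw, h.cl_eq_of_adj hδ hvw (by rw [hi, hw]), hw⟩

theorem IsClustering.cl_cl (h : IsClustering G δ cl) (hδ : NoTies δ) (v : V) :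
    cl (cl v) = cl v := by
  generalize hd : G.dist v (cl v) = d
  induction d generalizing v with
  | zero =>
    have hv := (h.reachable v).dist_eq_zero_iff.mp hd
    rw [← hv, ← hv]
  | succ d ih =>
    obtain ⟨w, -, hw, hwd⟩ := h.exists_parent hδ hd
    rw [← hw]
    exact ih w (by rw [hw, hwd])

/-- Compare the chosen centre with the candidate `v` itself, at distance `0`. -/
theorem IsClustering.dist_le (h : IsClustering G δ cl) {v : V} (hv : 0 ≤ δ v) :
    (G.dist v (cl v) : ℝ) ≤ δ (cl v) := by
  have := h.minimal v v (.refl v)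
  rw [SimpleGraph.dist_self] at this
  push_cast at this
  linarith

theorem SimpleGraph.dist_le_card [Fintype V] (v u : V) : G.dist v u ≤ Fintype.card V := by
  by_cases hr : G.Reachable v u
  · obtain ⟨p, hp, hl⟩ := hr.exists_path_of_dist
    rw [← hl]
    exact hp.length_lt.le
  · simp [SimpleGraph.dist_eq_zero_of_not_reachable hr]

/-! ### Centres of clusters near a vertex. -/

open Classical in
/-- The elements of `s` at which `δ - d` is within `2` of its maximum over `s`. -/
noncomputable def nearMax (s : Finset V) (d δ : V → ℝ) : Finset V :=
  s.filter fun u => ∀ u' ∈ s, δ u' - d u' ≤ δ u - d u + 2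

theorem mem_nearMax {s : Finset V} {d δ : V → ℝ} {u : V} :
    u ∈ nearMax s d δ ↔ u ∈ s ∧ ∀ u' ∈ s, δ u' - d u' ≤ δ u - d u + 2 := by
  simp [nearMax]

open Classical in
/-- The possible centres of the clusters that intersect the closed neighbourhood of `v`. -/
noncomputable def nearCentres [Fintype V] (G : SimpleGraph V) (δ : V → ℝ) (v : V) : Finset V :=
  nearMax (Finset.univ.filter fun u => G.Reachable v u) (fun u => G.dist v u) δ

theorem mem_nearCentres [Fintype V] {v u : V} :
    u ∈ nearCentres G δ v ↔ G.Reachable v u ∧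
      ∀ u', G.Reachable v u' → δ u' - G.dist v u' ≤ δ u - G.dist v u + 2 := by
  simp [nearCentres, mem_nearMax]

/-- Passing to a neighbour changes each of the two compared distances by at most `1`; this is the
slack `2` in `nearMax`. -/
theorem IsClustering.mem_nearCentres [Fintype V] (h : IsClustering G δ cl) {v w : V}
    (hw : w = v ∨ G.Adj v w) : cl w ∈ nearCentres G δ v := by
  rw [_root_.mem_nearCentres]
  rcases hw with rfl | hw
  · refine ⟨h.reachable w, fun u hu => ?_⟩
    linarith [h.minimal w u hu]
  · refine ⟨hw.reachable.trans (h.reachable w), fun u hu => ?_⟩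
    have h1 := h.minimal w u (hw.reachable.symm.trans hu)
    have h2 : (G.dist v (cl w) : ℝ) ≤ G.dist w (cl w) + 1 := by
      exact_mod_cast hw.dist_le_dist_add_one (h.reachable w)
    have h3 : (G.dist w u : ℝ) ≤ G.dist v u + 1 := by
      exact_mod_cast hw.symm.dist_le_dist_add_one hu
    linarith

/-- The index set of `u` has an element that is in no other index set from `B`. -/
def HasPrivateIndex {ℓ : ℕ} (S : V → Fin ℓ → Bool) (B : Finset V) (u : V) : Prop :=
  ∃ j, S u j = true ∧ ∀ x ∈ B, x ≠ u → S x j = false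

theorem IsClustering.goodClustering [Fintype V] {ℓ : ℕ} {S : V → Fin ℓ → Bool}
    (h : IsClustering G δ cl) (hδ : NoTies δ)
    (hS : ∀ v, ∀ u ∈ nearCentres G δ v, HasPrivateIndex S (nearCentres G δ v) u) :
    GoodClustering G cl S where
  centre := h.cl_cl hδ
  reachable := h.reachable
  parent _ _ hi := h.exists_parent hδ hi
  index v := by
    obtain ⟨j, hj, hj'⟩ := hS v (cl v) (h.mem_nearCentres (.inl rfl))
    exact ⟨j, hj, fun x hx hne => hj' _ (h.mem_nearCentres (.inr hx)) hne⟩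

end Clustering

/-! ### The number of clusters near a vertex -/

section Exponential

variable {β : ℝ}

theorem expMeasure_Ioi (hβ : 0 < β) {x : ℝ} (hx : 0 ≤ x) :
    expMeasure β (Set.Ioi x) = ENNReal.ofReal (Real.exp (-(β * x))) := by
  have := isProbabilityMeasure_expMeasure hβ
  have h1 : (expMeasure β).real (Set.Iic x) = 1 - Real.exp (-(β * x)) := by
    rw [← cdf_eq_real, cdf_expMeasure_eq hβ, if_pos hx]
  rw [← Set.compl_Iic, ← ofReal_measureReal, probReal_compl_eq_one_sub measurableSet_Iic, h1,
    sub_sub_cancel]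

theorem expMeasure_Iio_zero (hβ : 0 < β) : expMeasure β (Set.Iio 0) = 0 := by
  have := isProbabilityMeasure_expMeasure hβ
  have h0 := expMeasure_Ioi hβ le_rfl
  rw [mul_zero, neg_zero, Real.exp_zero, ENNReal.ofReal_one,
    prob_compl_eq_zero_iff₀ (μ := expMeasure β) (s := Set.Ioi 0)
      measurableSet_Ioi.nullMeasurableSet |>.symm, Set.compl_Ioi] at h0
  exact measure_mono_null Set.Iio_subset_Iic_self h0

theorem expMeasure_singleton (x : ℝ) : expMeasure β {x} = 0 := by
  rw [expMeasure, gammaMeasure]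
  exact withDensity_absolutelyContinuous _ _ (by simp)

/-- The exponential distribution is memoryless. -/
theorem expMeasure_Icc_le (hβ : 0 < β) (s : ℝ) :
    expMeasure β (Set.Icc s (s + 2)) ≤
      ENNReal.ofReal (1 - Real.exp (-(2 * β))) * expMeasure β (Set.Ici s) := by
  have := isProbabilityMeasure_expMeasure hβ
  have hq : 0 ≤ 1 - Real.exp (-(2 * β)) := by
    have : Real.exp (-(2 * β)) ≤ 1 := Real.exp_le_one_iff.mpr (by linarith)
    linarith
  rw [← ofReal_measureReal, ← ofReal_measureReal (s := Set.Ici s), ← ENNReal.ofReal_mul hq]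
  refine ENNReal.ofReal_le_ofReal ?_
  have hsplit : (expMeasure β).real (Set.Ici s) =
      (expMeasure β).real (Set.Icc s (s + 2)) + (expMeasure β).real (Set.Ioi (s + 2)) := by
    rw [← measureReal_union _ measurableSet_Ioi, Set.Icc_union_Ioi_eq_Ici (by linarith)]
    rw [Set.disjoint_left]
    intro x hx hx'
    exact absurd hx.2 (not_le.mpr hx')
  suffices h : Real.exp (-(2 * β)) * (expMeasure β).real (Set.Ici s) ≤
      (expMeasure β).real (Set.Ioi (s + 2)) by linarith
  have hreal : ∀ x, 0 ≤ x → (expMeasure β).real (Set.Ioi x) = Real.exp (-(β * x)) := by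
    intro x hx
    rw [measureReal_def, expMeasure_Ioi hβ hx, ENNReal.toReal_ofReal (Real.exp_nonneg _)]
  rcases le_or_gt 0 s with hs | hs
  · have hIci : (expMeasure β).real (Set.Ici s) = Real.exp (-(β * s)) := by
      rw [← hreal s hs, ← Set.Ioi_union_left, measureReal_union (by simp) (by simp),
        measureReal_def (s := {s}), expMeasure_singleton]
      simp
    rw [hreal _ (by linarith), hIci, ← Real.exp_add]
    exact (congrArg Real.exp (by ring)).le
  -- For negative `s` memorylessness is not exact, but bounding the mass above `s` by `1` suffices.
  · calc Real.exp (-(2 * β)) * (expMeasure β).real (Set.Ici s)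
        ≤ Real.exp (-(2 * β)) * 1 := by
          gcongr
          exact measureReal_le_one
      _ = (expMeasure β).real (Set.Ioi 2) := by
          rw [hreal 2 (by norm_num), mul_one, mul_comm]
      _ ≤ (expMeasure β).real (Set.Ioi (s + 2)) :=
          measureReal_mono (Set.Ioi_subset_Ioi (by linarith))

end Exponential

/-! ### Tail bound for the number of near-maximizers of shifted exponentials. -/

section NearMax

open Classical in
theorem lmarginal_prod_le_one {V : Type*} {μ : Measure ℝ} [IsProbabilityMeasure μ] {u₀ : V} {s : Finset V}
    (hu₀ : u₀ ∉ s) {g : V → ℝ → ℝ → ℝ≥0∞} (hg : ∀ u, Measurable fun p : ℝ × ℝ => g u p.1 p.2)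
    (h : ∀ u y, ∫⁻ x, g u y x ∂μ ≤ 1) :
    lmarginal (fun _ => μ) s (fun x => ∏ u ∈ s, g u (x u₀) (x u)) ≤ 1 := by
  have hmeas : ∀ t : Finset V, Measurable fun x : V → ℝ => ∏ u ∈ t, g u (x u₀) (x u) := fun t =>
    Finset.measurable_prod _ fun u _ =>
      (hg u).comp (f := fun x : V → ℝ => (x u₀, x u)) (by fun_prop)
  induction s using Finset.induction_on with
  | empty => exact fun x => by simp
  | insert i s hi ih =>
    rw [lmarginal_insert' _ (hmeas _) hi]
    -- The coordinates are integrated out one at a time. The coordinate `u₀` stays frozen, so each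
    -- integral meets a single factor.
    refine le_trans (lmarginal_mono fun x => ?_) (ih fun h => hu₀ (Finset.mem_insert_of_mem h))
    have hne : u₀ ≠ i := fun e => hu₀ (e ▸ Finset.mem_insert_self _ _)
    have : ∀ y, ∏ u ∈ insert i s, g u (Function.update x i y u₀) (Function.update x i y u) =
        g i (x u₀) y * ∏ u ∈ s, g u (x u₀) (x u) := by
      intro y
      rw [Finset.prod_insert hi, Function.update_of_ne hne, Function.update_self]
      congr 1
      refine Finset.prod_congr rfl fun u hu => ?_
      rw [Function.update_of_ne (fun e : u = i => hi (e ▸ hu))]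
    simp_rw [this]
    have hgi : Measurable (g i (x u₀)) := (hg i).comp (f := fun y => (x u₀, y)) (by fun_prop)
    rw [lintegral_mul_const _ hgi]
    exact mul_le_of_le_one_left' (h i _)

variable {V : Type*} [Fintype V] {β : ℝ}

/-- The weight `1` below `y`, `q⁻¹` on `[y, y + 2]` and `0` above `y + 2`. -/
noncomputable def shellWeight (q : ℝ≥0∞) (y x : ℝ) : ℝ≥0∞ :=
  if x < y then 1 else if x ≤ y + 2 then q⁻¹ else 0

theorem measurable_shellWeight (q : ℝ≥0∞) :
    Measurable fun p : ℝ × ℝ => shellWeight q p.1 p.2 := by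
  refine Measurable.ite (measurableSet_lt measurable_snd measurable_fst) measurable_const
    (Measurable.ite (measurableSet_le measurable_snd (measurable_fst.add_const 2))
      measurable_const measurable_const)

/-- By memorylessness the shell has at most a fraction `q` of the mass above its lower end, so
weighting it by `q⁻¹` yields no more than all of that mass. -/
theorem lintegral_shellWeight_le (hβ : 0 < β) (y d : ℝ) :
    ∫⁻ x, shellWeight (ENNReal.ofReal (1 - Real.exp (-(2 * β)))) y (x - d) ∂expMeasure β ≤ 1 := by
  have := isProbabilityMeasure_expMeasure hβ
  set q := ENNReal.ofReal (1 - Real.exp (-(2 * β))) with hq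
  have hq0 : q ≠ 0 := by
    have : Real.exp (-(2 * β)) < 1 := Real.exp_lt_one_iff.mpr (by linarith)
    simp only [hq, ne_eq, ENNReal.ofReal_eq_zero, not_le]
    linarith
  have heq : ∀ x, shellWeight q y (x - d) = (Set.Iio (y + d)).indicator (fun _ => 1) x +
      (Set.Icc (y + d) (y + d + 2)).indicator (fun _ => q⁻¹) x := by
    intro x
    simp only [shellWeight, Set.indicator_apply, Set.mem_Iio, Set.mem_Icc, sub_lt_iff_lt_add,
      sub_le_iff_le_add, add_right_comm y 2 d]
    by_cases h1 : x < y + d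
    · simp [h1, not_le.mpr h1]
    · simp [h1, not_lt.mp h1]
  simp_rw [heq]
  rw [lintegral_add_left (measurable_const.indicator measurableSet_Iio),
    lintegral_indicator_const measurableSet_Iio, lintegral_indicator_const measurableSet_Icc,
    one_mul]
  calc _ ≤ expMeasure β (Set.Iio (y + d)) + q⁻¹ * (q * expMeasure β (Set.Ici (y + d))) := by
        gcongr
        exact expMeasure_Icc_le hβ _
    _ = expMeasure β (Set.Iio (y + d)) + expMeasure β (Set.Iio (y + d))ᶜ := by
        rw [← mul_assoc, ENNReal.inv_mul_cancel hq0 ENNReal.ofReal_ne_top, one_mul, Set.compl_Iio]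
    _ = 1 := by rw [measure_add_measure_compl measurableSet_Iio, measure_univ]

/-- Let `u₀` be the lowest near-maximizer. The at least `t` others lie in the shell of width `2`
above it, so the product `W u₀` of the shell weights is at least `q⁻¹ ^ t`. Its expectation is at
most `1`; Markov's inequality and a union over `u₀` conclude. -/
theorem measure_nearMax_card_gt_le (hβ : 0 < β) (s : Finset V) (d : V → ℝ) (t : ℕ) :
    (Measure.pi fun _ : V => expMeasure β) {δ | t < (nearMax s d δ).card} ≤
      Fintype.card V * ENNReal.ofReal (1 - Real.exp (-(2 * β))) ^ t := by
  classical
  have := isProbabilityMeasure_expMeasure hβ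
  set q := ENNReal.ofReal (1 - Real.exp (-(2 * β))) with hq
  have hq0 : q ≠ 0 := by
    have : Real.exp (-(2 * β)) < 1 := Real.exp_lt_one_iff.mpr (by linarith)
    simp only [hq, ne_eq, ENNReal.ofReal_eq_zero, not_le]
    linarith
  have hq1 : q ≤ 1 := by
    rw [hq, ENNReal.ofReal_le_one]
    linarith [Real.exp_pos (-(2 * β))]
  let W : V → (V → ℝ) → ℝ≥0∞ := fun u₀ δ =>
    ∏ u ∈ s.erase u₀, shellWeight q (δ u₀ - d u₀) (δ u - d u)
  have hW : ∀ u₀, Measurable (W u₀) := fun u₀ => Finset.measurable_prod _ fun u _ =>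
    (measurable_shellWeight q).comp (f := fun δ : V → ℝ => (δ u₀ - d u₀, δ u - d u)) (by fun_prop)
  have hint : ∀ u₀, ∫⁻ δ, W u₀ δ ∂(Measure.pi fun _ : V => expMeasure β) ≤ 1 := by
    intro u₀
    have h1 := lintegral_le_of_lmarginal_le (μ := fun _ : V => expMeasure β) (s.erase u₀) (hW u₀)
      (measurable_const (a := 1)) (by
        refine (lmarginal_prod_le_one (g := fun u y x => shellWeight q (y - d u₀) (x - d u))
          (Finset.notMem_erase u₀ s) (fun u => (measurable_shellWeight q).comp
            ((measurable_fst.sub_const _).prodMk (measurable_snd.sub_const _)))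
          fun u y => lintegral_shellWeight_le hβ _ _).trans ?_
        intro x
        simp [lmarginal])
    simpa using h1
  have hsub : {δ : V → ℝ | t < (nearMax s d δ).card} ⊆ ⋃ u₀, {δ | (q⁻¹) ^ t ≤ W u₀ δ} := by
    intro δ hδ
    have hne : (nearMax s d δ).Nonempty := Finset.card_pos.mp (Nat.zero_lt_of_lt hδ)
    obtain ⟨u₀, hu₀, hmin⟩ := Finset.exists_min_image (nearMax s d δ) (fun u => δ u - d u) hne
    refine Set.mem_iUnion.mpr ⟨u₀, ?_⟩
    have hu₀' := mem_nearMax.mp hu₀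
    have hone : 1 ≤ q⁻¹ := ENNReal.one_le_inv.mpr hq1
    calc (q⁻¹) ^ t ≤ (q⁻¹) ^ ((nearMax s d δ).erase u₀).card := by
          refine pow_le_pow_right₀ hone ?_
          rw [Finset.card_erase_of_mem hu₀]
          exact Nat.le_sub_one_of_lt hδ
      _ = ∏ u ∈ (nearMax s d δ).erase u₀, q⁻¹ := by rw [Finset.prod_const]
      _ = ∏ u ∈ (nearMax s d δ).erase u₀, shellWeight q (δ u₀ - d u₀) (δ u - d u) := by
          refine Finset.prod_congr rfl fun u hu => ?_
          have hu := Finset.mem_of_mem_erase hu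
          rw [shellWeight, if_neg (not_lt.mpr (hmin u hu)),
            if_pos (hu₀'.2 u (mem_nearMax.mp hu).1)]
      _ ≤ W u₀ δ := by
          -- The additional factors are `1` or `q⁻¹`. The weight `0` cannot occur, because nothing
          -- in `s` is more than `2` above the near-maximizer `u₀`.
          refine Finset.prod_le_prod_of_subset_of_one_le'
            (Finset.erase_subset_erase _ (fun u hu => (mem_nearMax.mp hu).1)) fun u hu _ => ?_
          rw [shellWeight]
          split_ifs with h1 h2
          · exact le_rfl
          · exact hone
          · exact absurd (hu₀'.2 u (Finset.mem_of_mem_erase hu)) h2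
  calc _ ≤ (Measure.pi fun _ : V => expMeasure β) (⋃ u₀, {δ | (q⁻¹) ^ t ≤ W u₀ δ}) :=
        measure_mono hsub
    _ ≤ ∑ u₀, (Measure.pi fun _ : V => expMeasure β) {δ | (q⁻¹) ^ t ≤ W u₀ δ} :=
        measure_iUnion_fintype_le _ _
    _ ≤ ∑ u₀ : V, q ^ t := by
        refine Finset.sum_le_sum fun u₀ _ => ?_
        have h1 := (mul_meas_ge_le_lintegral (μ := Measure.pi fun _ : V => expMeasure β)
          (hW u₀) ((q⁻¹) ^ t)).trans (hint u₀)
        have hqt : q ^ t * (q⁻¹) ^ t = 1 := by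
          rw [← mul_pow, ENNReal.mul_inv_cancel hq0 ENNReal.ofReal_ne_top, one_pow]
        calc _ = q ^ t * ((q⁻¹) ^ t *
              (Measure.pi fun _ : V => expMeasure β) {δ | (q⁻¹) ^ t ≤ W u₀ δ}) := by
              rw [← mul_assoc, hqt, one_mul]
          _ ≤ q ^ t * 1 := by gcongr
          _ = q ^ t := mul_one _
    _ = _ := by simp

theorem measure_tie_eq_zero (hβ : 0 < β) {u u' : V} (h : u ≠ u') (z : ℝ) :
    (Measure.pi fun _ : V => expMeasure β) {δ | δ u - δ u' = z} = 0 := by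
  classical
  have := isProbabilityMeasure_expMeasure hβ
  have hm : MeasurableSet {δ : V → ℝ | δ u - δ u' = z} :=
    measurableSet_eq_fun ((measurable_pi_apply u).sub (measurable_pi_apply u')) measurable_const
  have h1 := lintegral_le_of_lmarginal_le (μ := fun _ : V => expMeasure β) {u}
    (measurable_one.indicator hm) (measurable_const (a := (0 : ℝ≥0∞))) (by
      rw [lmarginal_singleton, lmarginal_singleton]
      intro x
      -- With every coordinate but `u` fixed, the tie event is a single point, and the exponential
      -- law has no atoms.
      have : (fun y => {δ : V → ℝ | δ u - δ u' = z}.indicator (1 : (V → ℝ) → ℝ≥0∞)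
          (Function.update x u y)) = Set.indicator {z + x u'} 1 := by
        ext y
        simp [Set.indicator_apply, Function.update_of_ne h.symm, sub_eq_iff_eq_add]
      beta_reduce
      rw [this, lintegral_indicator_one (measurableSet_singleton _), expMeasure_singleton]
      simp)
  rw [lintegral_indicator_one hm] at h1
  simpa using h1

theorem measure_not_noTies (hβ : 0 < β) :
    (Measure.pi fun _ : V => expMeasure β) {δ | ¬ NoTies δ} = 0 := by
  have : {δ : V → ℝ | ¬ NoTies δ} ⊆
      ⋃ p : {p : V × V // p.1 ≠ p.2}, ⋃ z : ℤ, {δ | δ p.1.1 - δ p.1.2 = z} := by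
    intro δ hδ
    simp only [NoTies, Set.mem_ofPred_eq, not_forall, not_not] at hδ
    obtain ⟨u, u', hne, z, hz⟩ := hδ
    exact Set.mem_iUnion.mpr ⟨⟨(u, u'), hne⟩, Set.mem_iUnion.mpr ⟨z, hz⟩⟩
  refine measure_mono_null this ?_
  simp only [measure_iUnion_null_iff]
  exact fun p z => measure_tie_eq_zero hβ p.2 z

theorem measure_exists_neg (hβ : 0 < β) :
    (Measure.pi fun _ : V => expMeasure β) {δ | ∃ u, δ u < 0} = 0 := by
  have := isProbabilityMeasure_expMeasure hβ
  rw [Set.ofPred_exists, measure_iUnion_null_iff]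
  intro u
  have := (measurePreserving_eval (fun _ : V => expMeasure β) u).measure_preimage
    (measurableSet_Iio (a := 0)).nullMeasurableSet
  rw [expMeasure_Iio_zero hβ] at this
  exact this

theorem measure_exists_gt_le (hβ : 0 < β) {x : ℝ} (hx : 0 ≤ x) :
    (Measure.pi fun _ : V => expMeasure β) {δ | ∃ u, x < δ u} ≤
      Fintype.card V * ENNReal.ofReal (Real.exp (-(β * x))) := by
  have := isProbabilityMeasure_expMeasure hβ
  rw [Set.ofPred_exists]
  refine (measure_iUnion_fintype_le _ _).trans ?_
  have h : ∀ u, (Measure.pi fun _ : V => expMeasure β) {δ | x < δ u} =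
      ENNReal.ofReal (Real.exp (-(β * x))) := by
    intro u
    have := (measurePreserving_eval (fun _ : V => expMeasure β) u).measure_preimage
      (measurableSet_Ioi (a := x)).nullMeasurableSet
    rw [expMeasure_Ioi hβ hx] at this
    exact this
  simp [h]

end NearMax

/-! ### The shared index sets -/

section IndexSets

variable {V : Type*} [Fintype V] {ℓ c : ℕ}

theorem coin_true (p : ℝ) : coin p {true} = ENNReal.ofReal p := by
  simp [coin]

theorem coin_false (p : ℝ) : coin p {false} = ENNReal.ofReal (1 - p) := by
  simp [coin]

theorem isProbabilityMeasure_coin {p : ℝ} (h0 : 0 ≤ p) (h1 : p ≤ 1) :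
    IsProbabilityMeasure (coin p) where
  measure_univ := by
    simp only [coin, Measure.coe_add, Measure.coe_smul, Pi.add_apply, Pi.smul_apply, smul_eq_mul,
      measure_univ, mul_one]
    rw [← ENNReal.ofReal_add h0 (by linarith)]
    simp

theorem isProbabilityMeasure_coin_inv (c : ℕ) : IsProbabilityMeasure (coin (1 / c)) :=
  isProbabilityMeasure_coin (by positivity) (by
    rcases Nat.eq_zero_or_pos c with rfl | h
    · simp
    · rw [div_le_one (by exact_mod_cast h)]
      exact_mod_cast h)

/-- Drawing a Boolean matrix by rows or by columns gives the same law. -/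
theorem pi_pi_map_swap {ι κ : Type*} [Fintype ι] [Fintype κ] (μ : Measure Bool)
    [IsProbabilityMeasure μ] :
    (Measure.pi fun _ : ι => Measure.pi fun _ : κ => μ).map Function.swap =
      Measure.pi fun _ : κ => Measure.pi fun _ : ι => μ := by
  refine Measure.ext_of_singleton fun T => ?_
  rw [Measure.map_apply .of_discrete .of_discrete]
  have : Function.swap ⁻¹' {T} = ({Function.swap T} : Set (ι → κ → Bool)) := by
    ext S
    constructor
    · rintro rfl; rfl
    · rintro rfl; rfl
  rw [this]
  simp only [Measure.pi_singleton, Function.swap]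
  exact Finset.prod_comm

theorem measure_private_ge {μ : Measure Bool} [IsProbabilityMeasure μ] (B : Finset V) (u : V) :
    μ {true} * μ {false} ^ B.card ≤
      (Measure.pi fun _ : V => μ) {T | T u = true ∧ ∀ x ∈ B, x ≠ u → T x = false} := by
  classical
  have : {T : V → Bool | T u = true ∧ ∀ x ∈ B, x ≠ u → T x = false} =
      Set.pi Set.univ fun v => if v = u then {true} else if v ∈ B then {false} else Set.univ := by
    ext T
    simp only [Set.mem_ofPred_eq, Set.mem_univ_pi]
    constructor
    · rintro ⟨h1, h2⟩ v
      split_ifs with hv hB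
      · exact hv ▸ h1
      · exact h2 v hB hv
      · trivial
    · intro h
      refine ⟨by simpa using h u, fun x hx hne => by simpa [hx, hne] using h x⟩
  rw [this, Measure.pi_pi, ← Finset.mul_prod_erase _ _ (Finset.mem_univ u), if_pos rfl]
  gcongr
  have h1 : ∀ v ∈ Finset.univ.erase u,
      μ (if v = u then {true} else if v ∈ B then {false} else Set.univ) =
        if v ∈ B then μ {false} else 1 := by
    intro v hv
    rw [if_neg (Finset.ne_of_mem_erase hv)]
    split_ifs
    · rfl
    · exact measure_univ
  rw [Finset.prod_congr rfl h1, Finset.prod_ite, Finset.prod_const, Finset.prod_const_one, mul_one]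
  refine pow_le_pow_right_of_le_one' prob_le_one (Finset.card_le_card fun v hv => ?_)
  exact (Finset.mem_filter.mp hv).2

/-- A given index is private with probability at least `(1/c)(1 - 1/c)^|B| ≥ 1/(2c)`, by Bernoulli's
inequality. The columns of the Boolean matrix are independent, so the failures at the `ℓ` indices
multiply. -/
theorem measure_not_hasPrivateIndex_le (hc : 0 < c) {B : Finset V} (hB : 2 * B.card ≤ c) (u : V) :
    (Measure.pi fun _ : V => Measure.pi fun _ : Fin ℓ => coin (1 / c))
      {S | ¬ HasPrivateIndex S B u} ≤ ENNReal.ofReal (Real.exp (-(ℓ / (2 * c)))) := by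
  have := isProbabilityMeasure_coin_inv c
  set μ := coin (1 / c) with hμ
  have hc0 : (0 : ℝ) < c := by exact_mod_cast hc
  have hc1 : 1 / (c : ℝ) ≤ 1 := by
    rw [div_le_one hc0]; exact_mod_cast hc
  have hlow : 1 / (2 * c : ℝ) ≤ 1 / c * (1 - 1 / c) ^ B.card := by
    have h1 := one_add_mul_le_pow (a := -(1 / (c : ℝ))) (by linarith) B.card
    have h2 : (B.card : ℝ) * (1 / c) ≤ 1 / 2 := by
      rw [mul_one_div, div_le_div_iff₀ hc0 (by norm_num)]
      have : (2 * B.card : ℝ) ≤ c := by exact_mod_cast hB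
      linarith
    calc 1 / (2 * c : ℝ) = 1 / c * (1 / 2) := by field_simp
      _ ≤ 1 / c * (1 - 1 / c) ^ B.card := by
        gcongr
        rw [← sub_eq_add_neg] at h1
        linarith
  have hgood := measure_private_ge (μ := μ) B u
  set A := {T : V → Bool | T u = true ∧ ∀ x ∈ B, x ≠ u → T x = false} with hA
  have hbad : (Measure.pi fun _ : V => μ) Aᶜ ≤ ENNReal.ofReal (1 - 1 / (2 * c)) := by
    rw [prob_compl_eq_one_sub .of_discrete, ENNReal.ofReal_sub _ (by positivity),
      ENNReal.ofReal_one]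
    refine tsub_le_tsub_left ?_ _
    refine le_trans ?_ hgood
    rw [hμ, coin_true, coin_false, ← ENNReal.ofReal_pow (by linarith),
      ← ENNReal.ofReal_mul (by positivity)]
    exact ENNReal.ofReal_le_ofReal hlow
  have hset : {S : V → Fin ℓ → Bool | ¬ HasPrivateIndex S B u} =
      Function.swap ⁻¹' (Set.pi Set.univ fun _ : Fin ℓ => Aᶜ) := by
    ext S
    simp only [HasPrivateIndex, Set.mem_ofPred_eq, Set.mem_preimage, Set.mem_univ_pi, not_exists]
    rfl
  rw [hset, ← Measure.map_apply .of_discrete .of_discrete, pi_pi_map_swap, Measure.pi_pi]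
  calc ∏ _i : Fin ℓ, (Measure.pi fun _ : V => μ) Aᶜ
      ≤ ∏ _i : Fin ℓ, ENNReal.ofReal (1 - 1 / (2 * c)) :=
        Finset.prod_le_prod' fun _ _ => hbad
    _ = ENNReal.ofReal (1 - 1 / (2 * c)) ^ ℓ := by simp
    _ ≤ ENNReal.ofReal (Real.exp (-(1 / (2 * c)))) ^ ℓ := by
        gcongr
        exact Real.one_sub_le_exp_neg _
    _ = ENNReal.ofReal (Real.exp (-(ℓ / (2 * c)))) := by
        rw [← ENNReal.ofReal_pow (Real.exp_nonneg _), ← Real.exp_nat_mul]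
        congr 2
        ring

theorem lintegral_prod_pi_fintype {ι : Type*} [Fintype ι] (μ : Measure Bool)
    [IsProbabilityMeasure μ] (g : Bool → ℝ≥0∞) :
    ∫⁻ T, ∏ j, g (T j) ∂(Measure.pi fun _ : ι => μ) =
      (g true * μ {true} + g false * μ {false}) ^ Fintype.card ι := by
  classical
  rw [lintegral_fintype]
  simp_rw [Measure.pi_singleton, ← Finset.prod_mul_distrib]
  have := Finset.prod_univ_sum (fun _ : ι => (Finset.univ : Finset Bool))
    (fun _ b => g b * μ {b})
  rw [Fintype.piFinset_univ] at this
  rw [← this]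
  simp

open Classical in
-- Chernoff bound: the mean size is `2m`, and the expectation of `exp |S u|` is `(1 + (e - 1)/c)^ℓ ≤
-- exp (2ℓ/c) = exp (4m)` since `e ≤ 3`. Markov's inequality at level `exp (5m)` leaves `exp (-m)`.
theorem measure_card_index_ge_le (hc : 0 < c) (m : ℕ) (hℓ : ℓ = 2 * c * m) (u : V) :
    (Measure.pi fun _ : V => Measure.pi fun _ : Fin ℓ => coin (1 / c))
      {S | 5 * m < (Finset.univ.filter fun j => S u j = true).card} ≤
        ENNReal.ofReal (Real.exp (-m)) := by
  have := isProbabilityMeasure_coin_inv c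
  have hc0 : (0 : ℝ) < c := by exact_mod_cast hc
  have hc1 : 1 / (c : ℝ) ≤ 1 := by
    rw [div_le_one hc0]; exact_mod_cast hc
  let A : Set (Fin ℓ → Bool) := {T | 5 * m < (Finset.univ.filter fun j => T j = true).card}
  have hmarg := (measurePreserving_eval
    (fun _ : V => Measure.pi fun _ : Fin ℓ => coin (1 / c)) u).measure_preimage (s := A)
    MeasurableSet.of_discrete.nullMeasurableSet
  refine hmarg.le.trans ?_
  let g : Bool → ℝ≥0∞ := fun b => if b = true then ENNReal.ofReal (Real.exp 1) else 1
  have hg : ∀ T : Fin ℓ → Bool, ∏ j, g (T j) =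
      ENNReal.ofReal (Real.exp 1) ^ (Finset.univ.filter fun j => T j = true).card := by
    intro T
    simp only [g]
    rw [Finset.prod_ite, Finset.prod_const, Finset.prod_const_one, mul_one]
  have hint : ∫⁻ T, ∏ j, g (T j) ∂(Measure.pi fun _ : Fin ℓ => coin (1 / c)) ≤
      ENNReal.ofReal (Real.exp (4 * m)) := by
    rw [lintegral_prod_pi_fintype, coin_true, coin_false]
    simp only [g, if_true, Bool.false_eq_true, if_false, one_mul, Fintype.card_fin]
    rw [← ENNReal.ofReal_mul (Real.exp_nonneg _),
      ← ENNReal.ofReal_add (by positivity) (by linarith), ← ENNReal.ofReal_pow (by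
        have : 0 ≤ Real.exp 1 * (1 / c : ℝ) := by positivity
        linarith)]
    refine ENNReal.ofReal_le_ofReal ?_
    have he : Real.exp 1 ≤ 3 := by linarith [Real.exp_one_lt_d9]
    have h1 : Real.exp 1 * (1 / c) + (1 - 1 / c) ≤ Real.exp (2 / c) := by
      have h2 := Real.add_one_le_exp (2 / (c : ℝ))
      have h3 : Real.exp 1 * (1 / c) ≤ 3 * (1 / (c : ℝ)) := by gcongr
      have h4 : 2 / (c : ℝ) = 2 * (1 / c) := by ring
      linarith
    calc (Real.exp 1 * (1 / c) + (1 - 1 / c)) ^ ℓ ≤ Real.exp (2 / c) ^ ℓ := by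
          refine pow_le_pow_left₀ ?_ h1 _
          have : 0 ≤ Real.exp 1 * (1 / c : ℝ) := by positivity
          linarith
      _ = Real.exp (4 * m) := by
          rw [← Real.exp_nat_mul, hℓ]
          push_cast
          congr 1
          field_simp
          ring
  have hmarkov := (mul_meas_ge_le_lintegral (μ := Measure.pi fun _ : Fin ℓ => coin (1 / c))
    (f := fun T => ∏ j, g (T j)) .of_discrete (ENNReal.ofReal (Real.exp (5 * m)))).trans hint
  have hsub : A ⊆ {T | ENNReal.ofReal (Real.exp (5 * m)) ≤ ∏ j, g (T j)} := by
    intro T hT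
    change ENNReal.ofReal (Real.exp (5 * m)) ≤ ∏ j, g (T j)
    rw [hg, ← ENNReal.ofReal_pow (Real.exp_nonneg _), ← Real.exp_nat_mul]
    refine ENNReal.ofReal_le_ofReal (Real.exp_le_exp.mpr ?_)
    rw [mul_one]
    exact_mod_cast (show 5 * m < _ from hT).le
  have hE : ENNReal.ofReal (Real.exp (-(5 * m))) * ENNReal.ofReal (Real.exp (5 * m)) = 1 := by
    rw [← ENNReal.ofReal_mul (Real.exp_nonneg _), ← Real.exp_add]
    simp
  calc (Measure.pi fun _ : Fin ℓ => coin (1 / c)) A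
      ≤ (Measure.pi fun _ : Fin ℓ => coin (1 / c))
        {T | ENNReal.ofReal (Real.exp (5 * m)) ≤ ∏ j, g (T j)} := measure_mono hsub
    _ = ENNReal.ofReal (Real.exp (-(5 * m))) * (ENNReal.ofReal (Real.exp (5 * m)) *
        (Measure.pi fun _ : Fin ℓ => coin (1 / c))
          {T | ENNReal.ofReal (Real.exp (5 * m)) ≤ ∏ j, g (T j)}) := by
        rw [← mul_assoc, hE, one_mul]
    _ ≤ ENNReal.ofReal (Real.exp (-(5 * m))) * ENNReal.ofReal (Real.exp (4 * m)) := by gcongr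
    _ = ENNReal.ofReal (Real.exp (-m)) := by
        rw [← ENNReal.ofReal_mul (Real.exp_nonneg _), ← Real.exp_add]
        congr 2
        ring

end IndexSets

/-! ### The event on which the simulation works -/

section GoodEvent

variable {V : Type*} [Fintype V] {β : ℝ} {ℓ c : ℕ}

theorem isProbabilityMeasure_clusterMeasure (hβ : 0 < β) (c ℓ : ℕ) :
    IsProbabilityMeasure (clusterMeasure V β c ℓ) := by
  have := isProbabilityMeasure_expMeasure hβ
  have := isProbabilityMeasure_coin_inv c
  unfold clusterMeasure
  infer_instance

theorem clusterMeasure_fst (hβ : 0 < β) (A : Set (V → ℝ)) :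
    clusterMeasure V β c ℓ {ω | ω.1 ∈ A} = (Measure.pi fun _ : V => expMeasure β) A := by
  have := isProbabilityMeasure_expMeasure hβ
  have := isProbabilityMeasure_coin_inv c
  have h : {ω : (V → ℝ) × (V → Fin ℓ → Bool) | ω.1 ∈ A} = A ×ˢ Set.univ := by
    ext; simp
  rw [h, clusterMeasure, Measure.prod_prod, measure_univ, mul_one]

theorem clusterMeasure_snd (hβ : 0 < β) (A : Set (V → Fin ℓ → Bool)) :
    clusterMeasure V β c ℓ {ω | ω.2 ∈ A} =
      (Measure.pi fun _ : V => Measure.pi fun _ : Fin ℓ => coin (1 / c)) A := by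
  have := isProbabilityMeasure_expMeasure hβ
  have := isProbabilityMeasure_coin_inv c
  have h : {ω : (V → ℝ) × (V → Fin ℓ → Bool) | ω.2 ∈ A} = Set.univ ×ˢ A := by
    ext; simp
  rw [h, clusterMeasure, Measure.prod_prod, measure_univ, one_mul]

theorem measurableSet_nearCentres_eq (G : SimpleGraph V) (v : V) (B : Finset V) :
    MeasurableSet {δ | nearCentres G δ v = B} := by
  simp only [Finset.ext_iff, mem_nearCentres]
  refine measurableSet_setOfPred.mpr (Measurable.forall fun u => Measurable.iff (Measurable.and
    measurable_const (Measurable.forall fun u' => Measurable.imp measurable_const ?_))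
    measurable_const)
  exact measurableSet_setOfPred.mp (measurableSet_le (by fun_prop) (by fun_prop))

/-- The near centres are a function of `δ` alone, so by Fubini the bound for a fixed set `B` applies
for each `δ`. Measurability comes from splitting over the finitely many values of `B`. -/
theorem clusterMeasure_not_hasPrivateIndex_le (hβ : 0 < β) (hc : 0 < c) {t : ℕ}
    (ht : 2 * t ≤ c) (G : SimpleGraph V) (v u : V) :
    clusterMeasure V β c ℓ {ω | (nearCentres G ω.1 v).card ≤ t ∧
      ¬ HasPrivateIndex ω.2 (nearCentres G ω.1 v) u} ≤
        ENNReal.ofReal (Real.exp (-(ℓ / (2 * c)))) := by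
  have := isProbabilityMeasure_expMeasure hβ
  have := isProbabilityMeasure_coin_inv c
  have hmeas : MeasurableSet {ω : (V → ℝ) × (V → Fin ℓ → Bool) |
      (nearCentres G ω.1 v).card ≤ t ∧ ¬ HasPrivateIndex ω.2 (nearCentres G ω.1 v) u} := by
    have : {ω : (V → ℝ) × (V → Fin ℓ → Bool) |
        (nearCentres G ω.1 v).card ≤ t ∧ ¬ HasPrivateIndex ω.2 (nearCentres G ω.1 v) u} =
        ⋃ B : Finset V, {δ | nearCentres G δ v = B} ×ˢ
          {S | B.card ≤ t ∧ ¬ HasPrivateIndex S B u} := by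
      ext ω
      simp
    rw [this]
    exact MeasurableSet.iUnion fun B =>
      (measurableSet_nearCentres_eq G v B).prod .of_discrete
  rw [clusterMeasure, Measure.prod_apply hmeas]
  calc _ ≤ ∫⁻ _, ENNReal.ofReal (Real.exp (-(ℓ / (2 * c))))
        ∂(Measure.pi fun _ : V => expMeasure β) := by
        refine lintegral_mono fun δ => ?_
        by_cases h : (nearCentres G δ v).card ≤ t
        · refine (measure_mono fun S hS => ?_).trans (measure_not_hasPrivateIndex_le hc
            (B := nearCentres G δ v) (by lia) u)
          exact hS.2
        · have : Prod.mk δ ⁻¹' {ω : (V → ℝ) × (V → Fin ℓ → Bool) |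
              (nearCentres G ω.1 v).card ≤ t ∧
                ¬ HasPrivateIndex ω.2 (nearCentres G ω.1 v) u} = ∅ := by
            ext S
            simp [h]
          rw [this, measure_empty]
          exact zero_le
    _ = _ := by simp

open Classical in
/-- The outcomes for which the simulation works: the centres are unambiguous, the clusters have
radius at most `r`, every closed neighbourhood meets few clusters, each of which has a private
index there, and the index sets have at most `L` elements. -/
structure GoodOutcome (G : SimpleGraph V) (r : ℝ) (L : ℕ)
    (ω : (V → ℝ) × (V → Fin ℓ → Bool)) : Prop where
  noTies : NoTies ω.1
  nonneg : ∀ u, 0 ≤ ω.1 u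
  le_radius : ∀ u, ω.1 u ≤ r
  hasPrivateIndex : ∀ v u, HasPrivateIndex ω.2 (nearCentres G ω.1 v) u
  card_le : ∀ u, (Finset.univ.filter fun j => ω.2 u j = true).card ≤ L

theorem clusterMeasure_not_goodOutcome_le (hβ : 0 < β) (hc : 0 < c) {t : ℕ}
    (ht : 2 * t ≤ c) (m : ℕ) (hℓ : ℓ = 2 * c * m) (G : SimpleGraph V) :
    clusterMeasure V β c ℓ {ω | ¬ GoodOutcome G (m / β) (5 * m) ω} ≤
      Fintype.card V * ENNReal.ofReal (Real.exp (-m)) +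
      Fintype.card V * (Fintype.card V * ENNReal.ofReal (1 - Real.exp (-(2 * β))) ^ t) +
      Fintype.card V * (Fintype.card V * ENNReal.ofReal (Real.exp (-m))) +
      Fintype.card V * ENNReal.ofReal (Real.exp (-m)) := by
  classical
  set μ := clusterMeasure V β c ℓ with hμ
  have h1 : μ {ω | ω.1 ∈ {δ | ¬ NoTies δ}} = 0 := by
    rw [hμ, clusterMeasure_fst hβ, measure_not_noTies hβ]
  have h2 : μ {ω | ω.1 ∈ {δ | ∃ u, δ u < 0}} = 0 := by
    rw [hμ, clusterMeasure_fst hβ, measure_exists_neg hβ]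
  have h3 : μ {ω | ω.1 ∈ {δ | ∃ u, m / β < δ u}} ≤
      Fintype.card V * ENNReal.ofReal (Real.exp (-m)) := by
    rw [hμ, clusterMeasure_fst hβ]
    refine (measure_exists_gt_le hβ (by positivity)).trans ?_
    rw [mul_div_cancel₀ _ hβ.ne']
  have h4 : μ (⋃ v, {ω | ω.1 ∈ {δ | t < (nearCentres G δ v).card}}) ≤
      Fintype.card V * (Fintype.card V * ENNReal.ofReal (1 - Real.exp (-(2 * β))) ^ t) := by
    refine (measure_iUnion_fintype_le _ _).trans ((Finset.sum_le_sum fun v _ => ?_).trans_eq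
      (by rw [Finset.sum_const, nsmul_eq_mul, Finset.card_univ]))
    rw [hμ, clusterMeasure_fst hβ]
    exact measure_nearMax_card_gt_le hβ _ _ t
  have h5 : μ (⋃ v, ⋃ u, {ω | (nearCentres G ω.1 v).card ≤ t ∧
      ¬ HasPrivateIndex ω.2 (nearCentres G ω.1 v) u}) ≤
      Fintype.card V * (Fintype.card V * ENNReal.ofReal (Real.exp (-m))) := by
    refine (measure_iUnion_fintype_le _ _).trans ((Finset.sum_le_sum fun v _ => ?_).trans_eq
      (by rw [Finset.sum_const, nsmul_eq_mul, Finset.card_univ]))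
    refine (measure_iUnion_fintype_le _ _).trans ((Finset.sum_le_sum fun u _ => ?_).trans_eq
      (by rw [Finset.sum_const, nsmul_eq_mul, Finset.card_univ]))
    refine (clusterMeasure_not_hasPrivateIndex_le hβ hc ht G v u).trans_eq ?_
    have : (c : ℝ) ≠ 0 := by exact_mod_cast hc.ne'
    rw [hℓ]
    push_cast
    congr 3
    field_simp
  have h6 : μ (⋃ u, {ω | ω.2 ∈
      {S | 5 * m < (Finset.univ.filter fun j => S u j = true).card}}) ≤
      Fintype.card V * ENNReal.ofReal (Real.exp (-m)) := by
    refine (measure_iUnion_fintype_le _ _).trans ((Finset.sum_le_sum fun u _ => ?_).trans_eq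
      (by rw [Finset.sum_const, nsmul_eq_mul, Finset.card_univ]))
    rw [hμ, clusterMeasure_snd hβ]
    exact measure_card_index_ge_le hc m hℓ u
  have hsub : {ω | ¬ GoodOutcome G (m / β) (5 * m) ω} ⊆
      ({ω | ω.1 ∈ {δ | ¬ NoTies δ}} ∪ {ω | ω.1 ∈ {δ | ∃ u, δ u < 0}}) ∪
      {ω | ω.1 ∈ {δ | ∃ u, m / β < δ u}} ∪
      (⋃ v, {ω | ω.1 ∈ {δ | t < (nearCentres G δ v).card}}) ∪
      (⋃ v, ⋃ u, {ω | (nearCentres G ω.1 v).card ≤ t ∧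
        ¬ HasPrivateIndex ω.2 (nearCentres G ω.1 v) u}) ∪
      (⋃ u, {ω : (V → ℝ) × (V → Fin ℓ → Bool) | ω.2 ∈
        {S | 5 * m < (Finset.univ.filter fun j => S u j = true).card}}) := by
    intro ω hω
    by_contra hcon
    simp only [Set.mem_union, Set.mem_iUnion, Set.mem_ofPred_eq, not_or, not_exists, not_and,
      not_not, not_lt] at hcon
    obtain ⟨⟨⟨⟨⟨g1, g2⟩, g3⟩, g4⟩, g5⟩, g6⟩ := hcon
    exact hω ⟨g1, g2, g3, fun v u => g5 v u (g4 v), g6⟩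
  refine (measure_mono hsub).trans ((measure_union_le _ _).trans (add_le_add ?_ h6))
  refine (measure_union_le _ _).trans (add_le_add ?_ h5)
  refine (measure_union_le _ _).trans (add_le_add ?_ h4)
  refine (measure_union_le _ _).trans ?_
  rw [measure_union_null h1 h2, zero_add]
  exact h3

theorem exists_measurableSet_goodOutcome (hβ : 0 < β) (hc : 0 < c) {t : ℕ}
    (ht : 2 * t ≤ c) (m : ℕ) (hℓ : ℓ = 2 * c * m) (G : SimpleGraph V) {n : ℕ}
    (hn : Fintype.card V ≤ n) {ε : ℝ} (hε : Real.exp (-m) ≤ ε)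
    (hε' : (1 - Real.exp (-(2 * β))) ^ t ≤ ε) :
    ∃ E : Set ((V → ℝ) × (V → Fin ℓ → Bool)), MeasurableSet E ∧
      1 - 4 * n ^ 2 * ε ≤ (clusterMeasure V β c ℓ).real E ∧
      ∀ ω ∈ E, GoodOutcome G (m / β) (5 * m) ω := by
  have := isProbabilityMeasure_clusterMeasure (V := V) hβ c ℓ
  set μ := clusterMeasure V β c ℓ
  have hq : 0 ≤ 1 - Real.exp (-(2 * β)) := by
    have : Real.exp (-(2 * β)) ≤ 1 := Real.exp_le_one_iff.mpr (by linarith)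
    linarith
  have hε0 : 0 ≤ ε := (Real.exp_nonneg _).trans hε
  have hbad : μ {ω | ¬ GoodOutcome G (m / β) (5 * m) ω} ≤ ENNReal.ofReal (4 * n ^ 2 * ε) := by
    refine (clusterMeasure_not_goodOutcome_le hβ hc ht m hℓ G).trans ?_
    rw [← ENNReal.ofReal_pow hq, ← ENNReal.ofReal_natCast]
    simp only [← ENNReal.ofReal_mul (Nat.cast_nonneg (α := ℝ) (Fintype.card V))]
    rw [← ENNReal.ofReal_add (by positivity) (by positivity),
      ← ENNReal.ofReal_add (by positivity) (by positivity),
      ← ENNReal.ofReal_add (by positivity) (by positivity)]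
    refine ENNReal.ofReal_le_ofReal ?_
    have hN : (Fintype.card V : ℝ) ≤ n := by exact_mod_cast hn
    have hN2 : (n : ℝ) ≤ n * n := by exact_mod_cast Nat.le_mul_self n
    have e1 : (Fintype.card V : ℝ) * Real.exp (-m) ≤ n * n * ε := by
      calc _ ≤ (n : ℝ) * ε := by gcongr
        _ ≤ n * n * ε := by gcongr
    have e2 : (Fintype.card V : ℝ) * (Fintype.card V * (1 - Real.exp (-(2 * β))) ^ t) ≤
        n * n * ε := by
      rw [mul_assoc]
      gcongr
    have e3 : (Fintype.card V : ℝ) * (Fintype.card V * Real.exp (-m)) ≤ n * n * ε := by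
      rw [mul_assoc]
      gcongr
    linarith
  -- Removing a measurable hull of the bad outcomes, of the same measure, avoids proving
  -- `GoodOutcome` measurable.
  refine ⟨(toMeasurable μ {ω | ¬ GoodOutcome G (m / β) (5 * m) ω})ᶜ,
    (measurableSet_toMeasurable _ _).compl, ?_, ?_⟩
  · rw [probReal_compl_eq_one_sub (measurableSet_toMeasurable _ _), measureReal_def,
      measure_toMeasurable]
    have := ENNReal.toReal_le_of_le_ofReal (by positivity) hbad
    linarith
  · intro ω hω
    by_contra h
    exact hω (subset_toMeasurable _ _ h)

end GoodEvent

/-! ### The choice of the parameters -/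

section Parameters

/-- This is `1 - exp(-2/k) ≤ k^(-1/3)`. A power smaller than `1` absorbs the factor in `1 -
exp(-2/k) ≤ 2/k`: cubed, the claim needs only `8 ≤ k²`, which holds from `k = 3` on. The case `k =
2` is numerical. -/
theorem one_sub_exp_le {k : ℕ} (hk : 2 ≤ k) :
    1 - Real.exp (-(2 * (1 / (k : ℝ)))) ≤ Real.exp (-(Real.log k / 3)) := by
  have hk0 : (0 : ℝ) < k := by exact_mod_cast (by lia : 0 < k)
  set x := 1 - Real.exp (-(2 * (1 / (k : ℝ)))) with hx
  have hx0 : 0 ≤ x := by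
    have : Real.exp (-(2 * (1 / (k : ℝ)))) ≤ 1 := Real.exp_le_one_iff.mpr (by
      have : 0 < 1 / (k : ℝ) := by positivity
      linarith)
    linarith
  have hcube : x ^ 3 ≤ 1 / k := by
    rcases hk.eq_or_lt with rfl | hk3
    · have h1 : (0.36 : ℝ) ≤ Real.exp (-1) := by
        rw [Real.exp_neg, le_inv_comm₀ (by norm_num) (Real.exp_pos _)]
        exact Real.exp_one_lt_d9.le.trans (by norm_num)
      have h2 : x ≤ 0.64 := by
        have : -(2 * (1 / ((2 : ℕ) : ℝ))) = -1 := by norm_num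
        rw [hx, this]
        linarith
      calc x ^ 3 ≤ 0.64 ^ 3 := pow_le_pow_left₀ hx0 h2 3
        _ ≤ _ := by norm_num
    · have h1 : x ≤ 2 / k := by
        have := Real.add_one_le_exp (-(2 * (1 / (k : ℝ))))
        have h2 : 2 / (k : ℝ) = 2 * (1 / k) := by ring
        linarith
      have h3 : (3 : ℝ) ≤ k := by exact_mod_cast hk3
      calc x ^ 3 ≤ (2 / k) ^ 3 := pow_le_pow_left₀ hx0 h1 3
        _ = 1 / k * (8 / k ^ 2) := by field_simp; norm_num
        _ ≤ 1 / k * 1 := by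
          gcongr
          rw [div_le_one (by positivity)]
          nlinarith
        _ = 1 / k := mul_one _
  refine (pow_le_pow_iff_left₀ hx0 (Real.exp_nonneg _) (three_ne_zero)).mp (hcube.trans ?_)
  rw [← Real.exp_nat_mul, show ((3 : ℕ) : ℝ) * -(Real.log k / 3) = -Real.log k by push_cast; ring,
    Real.exp_neg, Real.exp_log hk0, one_div]

theorem exp_neg_log_mul {n : ℕ} (hn : 0 < n) (a : ℕ) :
    Real.exp (-(a * Real.log n)) = 1 / (n : ℝ) ^ a := by
  rw [Real.exp_neg, Real.exp_nat_mul, Real.exp_log (by exact_mod_cast hn), one_div]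

theorem half_le_log {n : ℕ} (hn : 2 ≤ n) : 1 / 2 ≤ Real.log n := by
  have h1 : Real.log 2 ≤ Real.log n := Real.log_le_log (by norm_num) (by exact_mod_cast hn)
  linarith [Real.log_two_gt_d9]

/-- The danger is the `+ 1` from rounding `t` up. If `k < n²`, then `log n / log k ≥ 1/2` absorbs
it. Otherwise `t` is merely bounded, and the missing factor `1/log k` comes from `D = n ≤ √k ≤ 2k /
log k`. -/
theorem length_bound {n k m t D : ℕ} {A : ℝ} (hA : 6 ≤ A) (hn : 2 ≤ n) (hk : 2 ≤ k)
    (hm : (m : ℝ) ≤ A * Real.log n)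
    (ht : (t : ℝ) ≤ 3 * (A - 2) * (Real.log n / Real.log k) + 1)
    (hD : D = if n ^ 2 ≤ k then n else k * m) :
    (2 * (D * (2 * (2 * t) * m)) + 1 : ℝ) ≤
      (24 * A ^ 3 + 128 * A ^ 2 + 8) * (k * Real.log n ^ 3 / Real.log k) := by
  have hx := half_le_log hn
  have hy := half_le_log hk
  have hk0 : (0 : ℝ) < k := by exact_mod_cast (by lia : 0 < k)
  have hn0 : (0 : ℝ) < n := by exact_mod_cast (by lia : 0 < n)
  have hky : Real.log k ≤ k := (Real.log_le_sub_one_of_pos hk0).trans (by linarith)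
  set x := Real.log n with hxdef
  set y := Real.log k with hydef
  have hx0 : 0 < x := by linarith
  have hy0 : 0 < y := by linarith
  have hR : 1 ≤ 8 * (k * x ^ 3 / y) := by
    rw [← mul_div_assoc, le_div_iff₀ hy0]
    have h1 : (1 / 2 : ℝ) ^ 3 ≤ x ^ 3 := pow_le_pow_left₀ (by norm_num) hx 3
    nlinarith
  have hR0 : 0 ≤ k * x ^ 3 / y := by positivity
  suffices h : (D : ℝ) * t * m * 8 ≤ (24 * A ^ 3 + 128 * A ^ 2) * (k * x ^ 3 / y) by
    linarith
  by_cases hkn : n ^ 2 ≤ k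
  · rw [if_pos hkn] at hD
    have hxy : 2 * x ≤ y := by
      have h1 : Real.log ((n : ℝ) ^ 2) ≤ y :=
        Real.log_le_log (by positivity) (by exact_mod_cast hkn)
      rwa [Real.log_pow] at h1
    have ht' : (t : ℝ) ≤ 2 * A := by
      have h1 : x / y ≤ 1 / 2 := by
        rw [div_le_iff₀ hy0]; linarith
      nlinarith
    have hn' : (n : ℝ) ≤ 2 * k / y := by
      rw [le_div_iff₀ hy0]
      have h1 : (n : ℝ) ≤ √k := Real.le_sqrt_of_sq_le (by exact_mod_cast hkn)
      have h2 : y ≤ 2 * √k := by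
        have h3 := Real.log_le_sub_one_of_pos (Real.sqrt_pos.mpr hk0)
        rw [Real.log_sqrt hk0.le] at h3
        linarith
      calc (n : ℝ) * y ≤ √k * (2 * √k) := by gcongr
        _ = 2 * (√k * √k) := by ring
        _ = 2 * k := by rw [Real.mul_self_sqrt hk0.le]
    have hm' : (m : ℝ) ≤ 4 * A * x ^ 3 := by
      have h1 : (1 / 2 : ℝ) ^ 2 ≤ x ^ 2 := pow_le_pow_left₀ (by norm_num) hx 2
      have h2 : x ≤ 4 * x ^ 3 := by nlinarith
      calc (m : ℝ) ≤ A * x := hm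
        _ ≤ A * (4 * x ^ 3) := by gcongr
        _ = _ := by ring
    calc (D : ℝ) * t * m * 8 ≤ (2 * k / y) * (2 * A) * (4 * A * x ^ 3) * 8 := by
          rw [hD]; gcongr
      _ = 128 * A ^ 2 * (k * x ^ 3 / y) := by ring
      _ ≤ _ := by
          gcongr
          have : 0 ≤ A ^ 3 := by positivity
          linarith
  · rw [if_neg hkn] at hD
    have hxy : y ≤ 2 * x := by
      have h1 : y ≤ Real.log ((n : ℝ) ^ 2) :=
        Real.log_le_log hk0 (by exact_mod_cast (not_le.mp hkn).le)
      rwa [Real.log_pow] at h1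
    have ht' : (t : ℝ) ≤ 3 * A * (x / y) := by
      have h1 : 1 ≤ 2 * (x / y) := by
        rw [← mul_div_assoc, le_div_iff₀ hy0]; linarith
      have : 0 ≤ x / y := by positivity
      nlinarith
    have hD' : (D : ℝ) ≤ k * (A * x) := by
      rw [hD]; push_cast; gcongr
    calc (D : ℝ) * t * m * 8 ≤ (k * (A * x)) * (3 * A * (x / y)) * (A * x) * 8 := by gcongr
      _ = 24 * A ^ 3 * (k * x ^ 3 / y) := by ring
      _ ≤ _ := by
          gcongr
          have : 0 ≤ A ^ 2 := by positivity
          linarith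

end Parameters

/-! ### Choice of the parameters and conclusion. -/

theorem lemma3p2 (b : ℕ) :
    ∃ K : ℝ, ∀ (n : ℕ) (β : ℝ), 2 ≤ n → 0 < β → β < 1 → (∃ k : ℕ, 1 / β = k) →
      ∃ c ℓ D : ℕ, 0 < c ∧
        -- the number of calls to Local-Broadcast on `G`
        (∀ (M : Type v) (I : Type w), ((simulation M I ℓ D).length : ℝ) ≤
          K * (Real.log n ^ 3 / (β * Real.log (1 / β)))) ∧
        ∀ (V : Type u) [Fintype V] (G : SimpleGraph V), Fintype.card V ≤ n →
          -- with high probability over the clustering and the shared index sets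
          ∃ E : Set ((V → ℝ) × (V → Fin ℓ → Bool)), MeasurableSet E ∧
            1 - 1 / (n : ℝ) ^ b ≤ (clusterMeasure V β c ℓ).real E ∧
            ∀ ω ∈ E, ∀ cl : V → V, IsClustering G ω.1 cl →
              ∀ (M : Type v) (I : Type w) (ident : V → I), Function.Injective ident →
              ∀ (f : ℝ≥0∞) (LB : (V → LBAction (M × I)) → PMF (V → Option (M × I))),
                IsLocalBroadcast G LB f →
                  IsLocalBroadcast (clusterGraph G cl)
                    (simulatedLB (M := M) G cl ident ω.2 D LB) (3 * n * f) ∧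
                  -- the number of calls in which each vertex participates
                  ∀ (a : Set.range cl → LBAction M),
                    ∀ p ∈ (simulationRun G cl ident ω.2 D LB a).support,
                      ∀ v, (p.2 v : ℝ) ≤ K * Real.log n := by
  -- Rounding `(b + 4) log n` up costs at most `1 ≤ 2 log n`, whence `b + 6`.
  set A : ℝ := b + 6 with hA
  have hA6 : 6 ≤ A := by
    have : (0 : ℝ) ≤ b := Nat.cast_nonneg b
    linarith
  refine ⟨24 * A ^ 3 + 128 * A ^ 2 + 8 + (20 * A + 2), ?_⟩
  rintro n β hn hβ hβ1 ⟨k, hk⟩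
  have hβk : β = 1 / k := by rw [← hk, one_div_one_div]
  have hk2 : 2 ≤ k := by
    have h1 : 1 < 1 / β := (one_lt_div hβ).mpr hβ1
    rw [hk] at h1
    exact_mod_cast h1
  have hx := half_le_log hn
  have hy := half_le_log hk2
  have hn0 : (0 : ℝ) < n := by exact_mod_cast (by lia : 0 < n)
  have hk0 : (0 : ℝ) < k := by exact_mod_cast (by lia : 0 < k)
  have hxy : 0 < Real.log n / Real.log k := div_pos (by linarith) (by linarith)
  -- Both `exp (-m)` and `q^t` have to be at most `n^(-(b+4))`: the union bound loses `4n² ≤ n⁴`.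
  -- The factor `3` in `t` undoes the exponent in `q ≤ k^(-1/3)`.
  set m := ⌈((b + 4 : ℕ) : ℝ) * Real.log n⌉₊ with hm
  set t := ⌈3 * ((b + 4 : ℕ) : ℝ) * (Real.log n / Real.log k)⌉₊ with ht
  set D := if n ^ 2 ≤ k then n else k * m with hD
  have htpos : 0 < t := Nat.ceil_pos.mpr (by positivity)
  have hmle : ((b + 4 : ℕ) : ℝ) * Real.log n ≤ m := Nat.le_ceil _
  have htle : 3 * ((b + 4 : ℕ) : ℝ) * (Real.log n / Real.log k) ≤ t := Nat.le_ceil _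
  have hmA : (m : ℝ) ≤ A * Real.log n := by
    have h1 : (m : ℝ) < ((b + 4 : ℕ) : ℝ) * Real.log n + 1 :=
      Nat.ceil_lt_add_one (mul_nonneg (Nat.cast_nonneg _) (by linarith))
    push_cast at h1
    rw [hA]
    linarith
  have htA : (t : ℝ) ≤ 3 * (A - 2) * (Real.log n / Real.log k) + 1 := by
    have h1 : (t : ℝ) < 3 * ((b + 4 : ℕ) : ℝ) * (Real.log n / Real.log k) + 1 :=
      Nat.ceil_lt_add_one (by positivity)
    have h2 : ((b + 4 : ℕ) : ℝ) = A - 2 := by rw [hA]; push_cast; ring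
    rw [h2] at h1
    exact h1.le
  have hε : Real.exp (-m) ≤ 1 / (n : ℝ) ^ (b + 4) := by
    rw [← exp_neg_log_mul (by lia)]
    exact Real.exp_le_exp.mpr (by linarith)
  have hq0 : 0 ≤ 1 - Real.exp (-(2 * β)) := by
    have : Real.exp (-(2 * β)) ≤ 1 := Real.exp_le_one_iff.mpr (by linarith)
    linarith
  have hε' : (1 - Real.exp (-(2 * β))) ^ t ≤ 1 / (n : ℝ) ^ (b + 4) := by
    have h1 := one_sub_exp_le hk2
    rw [← hβk] at h1
    refine (pow_le_pow_left₀ hq0 h1 t).trans ?_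
    rw [← Real.exp_nat_mul, ← exp_neg_log_mul (by lia)]
    refine Real.exp_le_exp.mpr ?_
    have h2 : 3 * ((b + 4 : ℕ) : ℝ) * Real.log n ≤ t * Real.log k := by
      rw [← mul_div_assoc, div_le_iff₀ (by linarith)] at htle
      exact htle
    linarith
  refine ⟨2 * t, 2 * (2 * t) * m, D, by lia, fun M I => ?_, fun V _ G hV => ?_⟩
  · rw [simulation_length, hk, hβk]
    have h1 := length_bound hA6 hn hk2 hmA htA hD
    have h2 : Real.log n ^ 3 / (1 / k * Real.log k) = k * Real.log n ^ 3 / Real.log k := by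
      field_simp
    rw [h2]
    push_cast
    refine h1.trans ?_
    have h3 : 0 ≤ k * Real.log n ^ 3 / Real.log k :=
      div_nonneg (mul_nonneg hk0.le (pow_nonneg (by linarith) 3)) (by linarith)
    exact mul_le_mul_of_nonneg_right (by linarith) h3
  · obtain ⟨E, hE, hEp, hEω⟩ := exists_measurableSet_goodOutcome hβ (by lia : 0 < 2 * t) le_rfl m
      rfl G hV hε hε'
    refine ⟨E, hE, le_trans ?_ hEp, ?_⟩
    · have h1 : 4 * (n : ℝ) ^ 2 * (1 / (n : ℝ) ^ (b + 4)) ≤ 1 / (n : ℝ) ^ b := by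
        rw [mul_one_div, div_le_div_iff₀ (by positivity) (by positivity)]
        have h2 : (4 : ℝ) ≤ n ^ 2 := by
          have : (2 : ℝ) ≤ n := by exact_mod_cast hn
          nlinarith
        calc 4 * (n : ℝ) ^ 2 * (n : ℝ) ^ b ≤ n ^ 2 * n ^ 2 * n ^ b := by gcongr
          _ = 1 * (n : ℝ) ^ (b + 4) := by ring
      linarith
    · intro ω hω cl hcl M I ident hid f LB hLB
      have hgood := hEω ω hω
      have hdistn : ∀ v, G.dist v (cl v) ≤ n := fun v =>
        (SimpleGraph.dist_le_card v (cl v)).trans hV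
      have hdist : ∀ v, G.dist v (cl v) ≤ D := by
        intro v
        by_cases hkn : n ^ 2 ≤ k
        · rw [hD, if_pos hkn]; exact hdistn v
        · rw [hD, if_neg hkn]
          have h1 := (hcl.dist_le (hgood.nonneg v)).trans (hgood.le_radius (cl v))
          have h2 : (m : ℝ) / β = k * m := by rw [hβk]; field_simp
          rw [h2] at h1
          exact_mod_cast h1
      refine ⟨isLocalBroadcast_simulatedLB hLB hid
        (hcl.goodClustering hgood.noTies fun v u _ => hgood.hasPrivateIndex v u) hdist hdistn
        (by lia), fun a p hp v => ?_⟩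
      have h1 := simulationRun_participation_le hLB hid D v p hp
      have h2 := hgood.card_le (cl v)
      have h3 : (p.2 v : ℝ) ≤ 20 * m + 1 := by
        exact_mod_cast (show p.2 v ≤ 20 * m + 1 by lia)
      have h4 : (20 * m + 1 : ℝ) ≤ (20 * A + 2) * Real.log n := by linarith
      refine (h3.trans h4).trans ?_
      have h5 : 0 ≤ 24 * A ^ 3 + 128 * A ^ 2 + 8 := by positivity
      exact mul_le_mul_of_nonneg_right (by linarith) (by linarith)
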